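/- Let $p$ be a prime number and let $\pi=\mathbb{Z}_p\oplus\mathbb{Z}_p$, where $\mathbb{Z}_p=\mathbb{Z}/p\mathbb{Z}$. For a finite group $G$, the Hambleton--Kreck invariant $d(G)$ is the minimal $\mathbb{Z}$-rank of the abelian group $\Omega^3\mathbb{Z}\otimes_{\mathbb{Z}[G]}\mathbb{Z}$, where $\Omega^3\mathbb{Z}=\ker(P_2\to P_1)$ and the minimum is taken over all exact sequences $P_2\to P_1\to P_0\to\mathbb{Z}\to 0$ of $\mathbb{Z}[G]$-modules with $P_0,P_1,P_2$ finitely generated projective and $\mathbb{Z}$ the trivial module. A finite 2-complex $K$ is a finite graph together with finitely many 2-cells attached along closed edge paths; its Euler characteristic is $\chi(K)=\#\{\text{vertices}\}-\#\{\text{edges}\}+\#\{\text{2-cells}\}$, and $\pi_1(K)$ is its edge path group. Then: (a) $d(\pi)=1$. (b) Every connected finite 2-complex $K$ with $\pi_1(K)\cong\pi$ satisfies $\chi(K)\ge 2$. (c) $H_2(\pi;\mathbb{Z}_p)$ has rank $3$ over $\mathbb{Z}_p$. (d) The bound in (b) is attained: the 2-complex realising the standard presentation $\langle x,y\mid x^p,\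 y^p,\ [x,y]\rangle$ (one vertex, two edges, three 2-cells) is connected, has fundamental group isomorphic to $\pi$, and has Euler characteristic $2$. -/

import Mathlib

universe u

noncomputable section

/-! ### The invariant `d(π)` -/

/-- A projective resolution of length three `P₂ → P₁ → P₀ → ℤ → 0` of the trivial `ℤ[G]`-module
`ℤ` by finitely generated projective `ℤ[G]`-modules. -/
structure LengthThreeResolution (G : Type u) [Group G] where
  P₀ : ModuleCat.{u} (MonoidAlgebra ℤ G)
  P₁ : ModuleCat.{u} (MonoidAlgebra ℤ G)
  P₂ : ModuleCat.{u} (MonoidAlgebra ℤ G)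
  finite₀ : Module.Finite (MonoidAlgebra ℤ G) P₀
  finite₁ : Module.Finite (MonoidAlgebra ℤ G) P₁
  finite₂ : Module.Finite (MonoidAlgebra ℤ G) P₂
  projective₀ : Module.Projective (MonoidAlgebra ℤ G) P₀
  projective₁ : Module.Projective (MonoidAlgebra ℤ G) P₁
  projective₂ : Module.Projective (MonoidAlgebra ℤ G) P₂
  /-- the map onto `ℤ` with trivial `G`-action -/
  ε : P₀ →ₗ[MonoidAlgebra ℤ G] (Representation.trivial ℤ G ℤ).asModule
  d₁ : P₁ →ₗ[MonoidAlgebra ℤ G] P₀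
  d₂ : P₂ →ₗ[MonoidAlgebra ℤ G] P₁
  surjective_ε : Function.Surjective ε
  exact₀ : Function.Exact d₁ ε
  exact₁ : Function.Exact d₂ d₁

/-- The representative of `Ω³ℤ` given by a resolution: the kernel of `P₂ → P₁`. -/
abbrev LengthThreeResolution.Omega {G : Type*} [Group G] (R : LengthThreeResolution G) :
    Submodule (MonoidAlgebra ℤ G) R.P₂ :=
  LinearMap.ker R.d₂

/-- The abelian group `M ⊗_{ℤ[G]} ℤ`, for a `ℤ[G]`-module `M`: the quotient of `M` by the subgroup
generated by all `g • x - x` (the `G`-coinvariants of `M`). -/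
abbrev tensorTrivial (G : Type*) [Group G] (M : Type*) [AddCommGroup M]
    [Module (MonoidAlgebra ℤ G) M] : Type _ :=
  Representation.Coinvariants (Representation.ofModule' (k := ℤ) (G := G) M)

/-- The Hambleton–Kreck invariant `d(G)`: the minimal `ℤ`-rank of `Ω³ℤ ⊗_{ℤ[G]} ℤ` over all
representatives of `Ω³ℤ`. -/
def hambletonKreckD (G : Type u) [Group G] : ℕ :=
  sInf {n : ℕ | ∃ R : LengthThreeResolution G, n = Module.finrank ℤ (tensorTrivial G R.Omega)}

/-! ### Two-complexes -/

/-- A (combinatorial) 2-complex: a graph (the 1-skeleton, each edge being given with one of its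
orientations) together with a family of 2-cells attached along closed edge paths, which may
traverse edges in either direction. -/
structure TwoComplex : Type (u + 1) where
  /-- the 0-cells -/
  Vertex : Type u
  /-- the 1-cells, as arrows between their end points -/
  [edges : Quiver.{u, u} Vertex]
  /-- the 2-cells -/
  Face : Type u
  /-- the base point of the attaching path of a 2-cell -/
  base : Face → Vertex
  /-- the closed edge path along which a 2-cell is attached -/
  attach : ∀ f : Face, @Quiver.Path (Quiver.Symmetrify Vertex) _ (base f) (base f)

namespace TwoComplex

attribute [instance] TwoComplex.edges

/-- The 1-cells of a 2-complex. -/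
abbrev Edge (K : TwoComplex.{u}) : Type _ := Quiver.Total K.Vertex

/-- The 2-complex has finitely many cells. -/
structure IsFinite (K : TwoComplex.{u}) : Prop where
  vertex : Finite K.Vertex
  edge : Finite K.Edge
  face : Finite K.Face

/-- The 2-complex is nonempty, and any two of its vertices are joined by an edge path. -/
structure IsConnected (K : TwoComplex.{u}) : Prop where
  nonempty : Nonempty K.Vertex
  joined : ∀ x y : K.Vertex, Nonempty (@Quiver.Path (Quiver.Symmetrify K.Vertex) _ x y)

/-- The Euler characteristic of a (finite) 2-complex. -/
def eulerChar (K : TwoComplex.{u}) : ℤ :=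
  (Nat.card K.Vertex : ℤ) - (Nat.card K.Edge : ℤ) + (Nat.card K.Face : ℤ)

/-- The fundamental groupoid of the 1-skeleton: its arrows are the edge paths modulo insertion and
deletion of backtrackings. -/
abbrev GraphGroupoid (K : TwoComplex.{u}) : Type _ := Quiver.FreeGroupoid K.Vertex

/-- A vertex of `K`, as an object of the fundamental groupoid of the 1-skeleton. -/
abbrev pt (K : TwoComplex.{u}) (x : K.Vertex) : K.GraphGroupoid :=
  (Quiver.FreeGroupoid.of K.Vertex).obj x

/-- The class of the attaching path of a 2-cell in the fundamental groupoid of the 1-skeleton. -/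
def attachClass (K : TwoComplex.{u}) (f : K.Face) : K.pt (K.base f) ⟶ K.pt (K.base f) :=
  (CategoryTheory.Quotient.functor
    (Quiver.FreeGroupoid.redStep (V := K.Vertex))).map (K.attach f)

open CategoryTheory in
/-- The classes of the loops at `x` of the form `γ · ∂f · γ⁻¹`, with `f` a 2-cell and `γ` an edge
path from `x` to the base point of its attaching path. -/
def faceLoops (K : TwoComplex.{u}) (x : K.Vertex) : Set (K.pt x ⟶ K.pt x) :=
  {δ | ∃ (f : K.Face) (γ : K.pt x ⟶ K.pt (K.base f)), δ = γ ≫ K.attachClass f ≫ Groupoid.inv γ}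

/-- The fundamental (edge path) group of `K` at `x`: the fundamental group of the 1-skeleton modulo
the normal subgroup generated by the boundary loops of the 2-cells. -/
abbrev π₁ (K : TwoComplex.{u}) (x : K.Vertex) : Type _ :=
  (K.pt x ⟶ K.pt x) ⧸ Subgroup.normalClosure (K.faceLoops x)

/-- The edge path in the bouquet of circles with one circle for each `a : α` that is spelled by a
word in the letters `a^{±1}` (`(a, true)` stands for `a`, and `(a, false)` for `a⁻¹`). -/
def wordPath {α : Type} : List (α × Bool) →
    @Quiver.Path (Quiver.Symmetrify (Quiver.SingleObj α)) _
      (Quiver.SingleObj.star α) (Quiver.SingleObj.star α)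
  | [] => Quiver.Path.nil
  | (a, true) :: w => (Quiver.Hom.toPath (V := Quiver.Symmetrify (Quiver.SingleObj α))
      (a := Quiver.SingleObj.star α) (b := Quiver.SingleObj.star α) (Sum.inl a)).comp (wordPath w)
  | (a, false) :: w => (Quiver.Hom.toPath (V := Quiver.Symmetrify (Quiver.SingleObj α))
      (a := Quiver.SingleObj.star α) (b := Quiver.SingleObj.star α) (Sum.inr a)).comp (wordPath w)

/-- The 2-complex realising the presentation `⟨α | r i, i ∈ ι⟩`: one vertex, one edge for each
generator, and for each relator one 2-cell attached along the reduced word of the relator. -/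
abbrev ofPresentation {α ι : Type} [DecidableEq α] (r : ι → FreeGroup α) : TwoComplex.{0} where
  Vertex := Quiver.SingleObj α
  Face := ι
  base _ := Quiver.SingleObj.star α
  attach i := wordPath (r i).toWord

end TwoComplex

/-- The relators of the standard presentation `⟨x, y | x ^ p, y ^ p, [x, y]⟩`. -/
def standardRelators (p : ℕ) : Fin 3 → FreeGroup (Fin 2) :=
  let x : FreeGroup (Fin 2) := FreeGroup.of 0
  let y : FreeGroup (Fin 2) := FreeGroup.of 1
  ![x ^ p, y ^ p, x * y * x⁻¹ * y⁻¹]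

/-- The group `ℤ_p ⊕ ℤ_p`, written multiplicatively. -/
abbrev ZpZp (p : ℕ) : Type := Multiplicative (ZMod p × ZMod p)

end

/-!
The group `π = ℤ_p ⊕ ℤ_p` has the presentation `⟨x, y | x ^ p, y ^ p, [x, y]⟩`, and the theorem says
that no resolution and no 2-complex is more economical than this presentation. The reason is that
all its boundary maps vanish modulo `p` on coinvariants, so that it is minimal.

*The invariant `d(π)`.* For a finite group, the rank of the coinvariants is additive on short exact
sequences (`finrank_tensorTrivial_of_exact`), so the rank of `Ω³ℤ ⊗ ℤ` is `p₂ - p₁ + p₀ - 1`, where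
`pᵢ` is the rank of `Pᵢ ⊗ ℤ` (`LengthThreeResolution.finrank_Omega`). The `pᵢ` can be computed
modulo `p`, since coinvariants of projectives are free. By Schanuel's lemma the kernel of
`P₁ → P₀` is stably equivalent to the kernel of `ℤ[π]² → ℤ[π]` in the standard resolution, so a
lower bound for the number of generators of the latter modulo `p` bounds `p₂ - p₁ + p₀` from below
(`LengthThreeResolution.modPRank_ker_add_le`). That number is at least three, because the relations
between the three standard generators have coefficients with augmentation divisible by `p`
(`three_le_modPRank_ker_stdD₁`). The standard resolution itself attains the bound.

*The second homology group.* A functional on 2-chains that vanishes on boundaries is a 2-cocycle,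
and defines a central extension. The extension splits once the three relators hold for lifts of the
generators (`exists_coboundary_of_relators`), so a class is determined by three numbers in `ℤ_p`.
The two carry cocycles and a bilinear cocycle realise them independently.

*2-complexes.* The three cocycles together define a central extension of `π` by `ℤ_p³`. As the
fundamental groupoid of a graph is free, the loops of a 2-complex with fundamental group `π` map to
this extension, and a count of dimensions of spaces of 1-cochains gives the inequality
(`TwoComplex.two_le_eulerChar`).

*The standard complex.* Loops in a bouquet of circles are words in the generators, which identifies
the fundamental group (`nonempty_π₁_standardRelators`).
-/

noncomputable section

/-! ### Coinvariants of modules over a group ring -/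

section Coinvariants

variable {G : Type*} [Group G]

theorem ofModule'_apply_eq_smul {M : Type*} [AddCommGroup M] [Module (MonoidAlgebra ℤ G) M]
    (g : G) (x : M) :
    Representation.ofModule' (k := ℤ) (G := G) M g x = MonoidAlgebra.of ℤ G g • x := by
  simp [Representation.ofModule']

/-- The map `M ⊗_{ℤ[G]} ℤ → N ⊗_{ℤ[G]} ℤ` induced by a `ℤ[G]`-linear map `M → N`. -/
def tensorTrivialMap {M N : Type*} [AddCommGroup M] [Module (MonoidAlgebra ℤ G) M]
    [AddCommGroup N] [Module (MonoidAlgebra ℤ G) N] (f : M →ₗ[MonoidAlgebra ℤ G] N) :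
    tensorTrivial G M →ₗ[ℤ] tensorTrivial G N :=
  Representation.Coinvariants.map _ _
    { toLinearMap := f.toAddMonoidHom.toIntLinearMap
      isIntertwining' := fun g => by
        ext x
        simp [ofModule'_apply_eq_smul] }

/-- The class of an element of `M` in `M ⊗_{ℤ[G]} ℤ`. -/
def tensorTrivialMk {M : Type*} [AddCommGroup M] [Module (MonoidAlgebra ℤ G) M] :
    M →ₗ[ℤ] tensorTrivial G M :=
  Representation.Coinvariants.mk (Representation.ofModule' (k := ℤ) (G := G) M)

variable {M N P : Type*} [AddCommGroup M] [Module (MonoidAlgebra ℤ G) M]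
  [AddCommGroup N] [Module (MonoidAlgebra ℤ G) N] [AddCommGroup P] [Module (MonoidAlgebra ℤ G) P]

theorem tensorTrivialMk_surjective :
    Function.Surjective (tensorTrivialMk : M →ₗ[ℤ] tensorTrivial G M) :=
  Representation.Coinvariants.mk_surjective _

@[simp]
theorem tensorTrivialMap_mk (f : M →ₗ[MonoidAlgebra ℤ G] N) (x : M) :
    tensorTrivialMap f (tensorTrivialMk x) = tensorTrivialMk (f x) := rfl

@[simp]
theorem tensorTrivialMk_of_smul (g : G) (x : M) :
    (tensorTrivialMk (MonoidAlgebra.of ℤ G g • x) : tensorTrivial G M) = tensorTrivialMk x := by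
  rw [← ofModule'_apply_eq_smul]
  exact Representation.Coinvariants.mk_self_apply _ g x

theorem tensorTrivial_hom_ext {A : Type*} [AddCommGroup A] {f g : tensorTrivial G M →ₗ[ℤ] A}
    (h : ∀ x, f (tensorTrivialMk x) = g (tensorTrivialMk x)) : f = g := by
  refine LinearMap.ext fun x => ?_
  obtain ⟨x, rfl⟩ := tensorTrivialMk_surjective x
  exact h x

/-- An additive map that is invariant under `G` factors through the coinvariants. -/
def tensorTrivialLift {A : Type*} [AddCommGroup A] (f : M →ₗ[ℤ] A)
    (hf : ∀ (g : G) (x : M), f (MonoidAlgebra.of ℤ G g • x) = f x) : tensorTrivial G M →ₗ[ℤ] A :=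
  Representation.Coinvariants.lift _ f fun g => by
    ext x
    simpa [ofModule'_apply_eq_smul] using hf g x

theorem tensorTrivialMap_comp (f : M →ₗ[MonoidAlgebra ℤ G] N) (g : N →ₗ[MonoidAlgebra ℤ G] P) :
    tensorTrivialMap (g ∘ₗ f) = tensorTrivialMap g ∘ₗ tensorTrivialMap f :=
  tensorTrivial_hom_ext fun _ => rfl

theorem tensorTrivialMap_id :
    tensorTrivialMap (LinearMap.id : M →ₗ[MonoidAlgebra ℤ G] M) = LinearMap.id :=
  tensorTrivial_hom_ext fun _ => rfl

theorem tensorTrivialMap_surjective {f : M →ₗ[MonoidAlgebra ℤ G] N} (hf : Function.Surjective f) :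
    Function.Surjective (tensorTrivialMap f) := by
  intro y
  obtain ⟨y, rfl⟩ := tensorTrivialMk_surjective y
  obtain ⟨x, rfl⟩ := hf y
  exact ⟨tensorTrivialMk x, rfl⟩

theorem ker_tensorTrivialMap_eq {f : M →ₗ[MonoidAlgebra ℤ G] N} {g : N →ₗ[MonoidAlgebra ℤ G] P}
    (hfg : Function.Exact f g) (hg : Function.Surjective g) :
    LinearMap.ker (tensorTrivialMap g) = LinearMap.range (tensorTrivialMap f) := by
  apply le_antisymm
  · intro y hy
    obtain ⟨y, rfl⟩ := tensorTrivialMk_surjective y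
    rw [LinearMap.mem_ker, tensorTrivialMap_mk] at hy
    have hy' := (Representation.Coinvariants.mk_eq_zero _).1 hy
    -- the kernel of `P → P_G` is the image of the kernel of `N → N_G`
    have hmap : Representation.Coinvariants.ker (Representation.ofModule' (k := ℤ) (G := G) P) ≤
        (Representation.Coinvariants.ker (Representation.ofModule' (k := ℤ) (G := G) N)).map
          g.toAddMonoidHom.toIntLinearMap := by
      refine Submodule.span_le.2 ?_
      rintro _ ⟨⟨s, z⟩, rfl⟩
      obtain ⟨z, rfl⟩ := hg z
      refine ⟨_, Representation.Coinvariants.sub_mem_ker s z, ?_⟩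
      simp [ofModule'_apply_eq_smul]
    obtain ⟨y', hy'mem, hy'eq⟩ := hmap hy'
    have hy'eq : g y' = g y := hy'eq
    obtain ⟨x, hx⟩ := (hfg (y - y')).1 (by rw [map_sub, hy'eq, sub_self])
    refine ⟨tensorTrivialMk x, ?_⟩
    rw [tensorTrivialMap_mk, hx, map_sub, sub_eq_self]
    exact (Representation.Coinvariants.mk_eq_zero _).2 hy'mem
  · rintro _ ⟨x, rfl⟩
    obtain ⟨x, rfl⟩ := tensorTrivialMk_surjective x
    simp [hfg.apply_apply_eq_zero]

/-- For an injective map `M → N`, the kernel of `M_G → N_G` is killed by the order of `G`: if the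
image of `x` is a sum of elements `g • y - y`, then `∑ g • x` vanishes, and in the coinvariants it
equals `|G| • x`. -/
theorem card_smul_eq_zero_of_mem_ker [Fintype G] {f : M →ₗ[MonoidAlgebra ℤ G] N}
    (hf : Function.Injective f) {x : tensorTrivial G M} (hx : tensorTrivialMap f x = 0) :
    Fintype.card G • x = 0 := by
  obtain ⟨x, rfl⟩ := tensorTrivialMk_surjective x
  set ρ := Representation.ofModule' (k := ℤ) (G := G) N
  have hker : Representation.Coinvariants.ker ρ ≤ LinearMap.ker (∑ g : G, ρ g) := by
    refine Submodule.span_le.2 ?_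
    rintro _ ⟨⟨s, z⟩, rfl⟩
    simp only [SetLike.mem_coe, LinearMap.mem_ker, map_sub, sub_eq_zero, LinearMap.sum_apply,
      ← Module.End.mul_apply, ← map_mul]
    exact Fintype.sum_equiv (Equiv.mulRight s) _ _ fun _ => rfl
  have h0 : ∑ g : G, MonoidAlgebra.of ℤ G g • x = 0 := by
    apply hf
    have := hker ((Representation.Coinvariants.mk_eq_zero _).1 hx)
    simpa [ρ, ofModule'_apply_eq_smul] using this
  have h1 := congrArg (tensorTrivialMk (G := G)) h0
  rw [map_sum, map_zero] at h1
  simpa only [tensorTrivialMk_of_smul, Finset.sum_const, Finset.card_univ] using h1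

instance finite_tensorTrivial [Module.Finite ℤ M] : Module.Finite ℤ (tensorTrivial G M) :=
  .of_surjective tensorTrivialMk tensorTrivialMk_surjective

end Coinvariants

/-- The `ℤ`-rank of the coinvariants is additive on short exact sequences, because the kernel of
`A_G → B_G` is torsion. -/
theorem finrank_tensorTrivial_of_exact {G : Type*} [Group G] [Finite G] {A B : Type u} {C : Type*}
    [AddCommGroup A] [Module (MonoidAlgebra ℤ G) A] [AddCommGroup B] [Module (MonoidAlgebra ℤ G) B]
    [AddCommGroup C] [Module (MonoidAlgebra ℤ G) C] [Module.Finite ℤ A] [Module.Finite ℤ B]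
    {f : A →ₗ[MonoidAlgebra ℤ G] B} {g : B →ₗ[MonoidAlgebra ℤ G] C} (hf : Function.Injective f)
    (hfg : Function.Exact f g) (hg : Function.Surjective g) :
    Module.finrank ℤ (tensorTrivial G B) =
      Module.finrank ℤ (tensorTrivial G A) + Module.finrank ℤ (tensorTrivial G C) := by
  cases nonempty_fintype G
  have htors : Module.finrank ℤ (LinearMap.ker (tensorTrivialMap f)) = 0 := by
    rw [Module.finrank_eq_zero_iff_isTorsion]
    rintro ⟨x, hx⟩
    refine ⟨⟨(Fintype.card G : ℤ), mem_nonZeroDivisors_of_ne_zero (by simp)⟩, ?_⟩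
    ext1
    simpa using card_smul_eq_zero_of_mem_ker hf hx
  have h1 := Submodule.finrank_quotient_add_finrank (LinearMap.ker (tensorTrivialMap f))
  have h2 := Submodule.finrank_quotient_add_finrank (LinearMap.ker (tensorTrivialMap g))
  rw [(tensorTrivialMap f).quotKerEquivRange.finrank_eq, htors] at h1
  rw [((tensorTrivialMap g).quotKerEquivOfSurjective
    (tensorTrivialMap_surjective hg)).finrank_eq, ker_tensorTrivialMap_eq hfg hg] at h2
  omega

theorem finrank_tensorTrivial_ker_add_range {G : Type*} [Group G] [Finite G] {B : Type u}
    {C : Type*} [AddCommGroup B] [Module (MonoidAlgebra ℤ G) B]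
    [AddCommGroup C] [Module (MonoidAlgebra ℤ G) C] [Module.Finite ℤ B]
    (f : B →ₗ[MonoidAlgebra ℤ G] C) :
    Module.finrank ℤ (tensorTrivial G B) =
      Module.finrank ℤ (tensorTrivial G (LinearMap.ker f)) +
        Module.finrank ℤ (tensorTrivial G (LinearMap.range f)) :=
  have : Module.Finite ℤ (LinearMap.ker f) :=
    .of_injective ((LinearMap.ker f).subtype.restrictScalars ℤ) Subtype.val_injective
  finrank_tensorTrivial_of_exact (Submodule.subtype_injective (LinearMap.ker f))
    (g := f.rangeRestrict) (fun x => by simp [Subtype.ext_iff]) f.surjective_rangeRestrict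

theorem finrank_tensorTrivial_trivial (G : Type*) [Group G] :
    Module.finrank ℤ (tensorTrivial G (Representation.trivial ℤ G ℤ).asModule) = 1 := by
  let e : tensorTrivial G (Representation.trivial ℤ G ℤ).asModule →ₗ[ℤ] ℤ :=
    tensorTrivialLift (Representation.trivial ℤ G ℤ).asModuleEquiv.toLinearMap fun g x => by
      simp
      rfl
  have he : Function.Bijective e := by
    constructor
    · intro x y hxy
      obtain ⟨x, rfl⟩ := tensorTrivialMk_surjective x
      obtain ⟨y, rfl⟩ := tensorTrivialMk_surjective y
      exact congrArg _ ((Representation.trivial ℤ G ℤ).asModuleEquiv.injective hxy)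
    · intro n
      exact ⟨tensorTrivialMk ((Representation.trivial ℤ G ℤ).asModuleEquiv.symm n), rfl⟩
  rw [(LinearEquiv.ofBijective e he).finrank_eq, Module.finrank_self]

theorem finite_int_of_finite_monoidAlgebra (G : Type*) [Group G] [Finite G] (M : Type*)
    [AddCommGroup M] [Module (MonoidAlgebra ℤ G) M] [Module.Finite (MonoidAlgebra ℤ G) M] :
    Module.Finite ℤ M :=
  .trans (MonoidAlgebra ℤ G) M

/-- The rank of `Ω³ℤ ⊗_{ℤ[G]} ℤ` is the Euler characteristic of the resolution minus one. -/
theorem LengthThreeResolution.finrank_Omega {G : Type u} [Group G] [Finite G]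
    (R : LengthThreeResolution G) :
    Module.finrank ℤ (tensorTrivial G R.Omega) + Module.finrank ℤ (tensorTrivial G R.P₁) + 1 =
      Module.finrank ℤ (tensorTrivial G R.P₂) + Module.finrank ℤ (tensorTrivial G R.P₀) := by
  have := R.finite₀
  have := R.finite₁
  have := R.finite₂
  have := finite_int_of_finite_monoidAlgebra G R.P₀
  have := finite_int_of_finite_monoidAlgebra G R.P₁
  have := finite_int_of_finite_monoidAlgebra G R.P₂
  have h2 : _ = Module.finrank ℤ (tensorTrivial G R.Omega) + _ :=
    finrank_tensorTrivial_ker_add_range R.d₂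
  have h1 := finrank_tensorTrivial_ker_add_range R.d₁
  have : Module.Finite ℤ (LinearMap.ker R.ε) :=
    .of_injective ((LinearMap.ker R.ε).subtype.restrictScalars ℤ) Subtype.val_injective
  have h0 := finrank_tensorTrivial_of_exact (Submodule.subtype_injective (LinearMap.ker R.ε))
    (g := R.ε) (fun x => by simp) R.surjective_ε
  rw [finrank_tensorTrivial_trivial, LinearMap.exact_iff.1 R.exact₀] at h0
  rw [LinearMap.exact_iff.1 R.exact₁] at h1
  omega

/-! ### The number of generators modulo `p` -/

/-- The dimension over `ℤ_p` of the space of `G`-invariant additive maps `M → ℤ_p`, which is dual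
to `M ⊗_{ℤ[G]} ℤ_p`. -/
def modPRank (p : ℕ) (G : Type*) [Group G] (M : Type*) [AddCommGroup M]
    [Module (MonoidAlgebra ℤ G) M] : ℕ :=
  Module.finrank (ZMod p) (tensorTrivial G M →ₗ[ℤ] ZMod p)

section ModPRank

variable {p : ℕ} [Fact p.Prime]

instance finite_intHom_zmod (A : Type*) [AddCommGroup A] [Module.Finite ℤ A] :
    Module.Finite (ZMod p) (A →ₗ[ℤ] ZMod p) := by
  obtain ⟨n, f, hf⟩ := Module.Finite.exists_fin' ℤ A
  exact .of_injective (LinearMap.lcomp (ZMod p) (ZMod p) f) fun a b h =>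
    (LinearMap.cancel_right hf).1 h

variable {G : Type*} [Group G] {M N : Type*} [AddCommGroup M] [Module (MonoidAlgebra ℤ G) M]
  [AddCommGroup N] [Module (MonoidAlgebra ℤ G) N]

theorem modPRank_le_of_surjective [Module.Finite ℤ M] (f : M →ₗ[MonoidAlgebra ℤ G] N)
    (hf : Function.Surjective f) : modPRank p G N ≤ modPRank p G M :=
  LinearMap.finrank_le_finrank_of_injective (f := LinearMap.lcomp (ZMod p) (ZMod p)
    (tensorTrivialMap f)) fun _ _ h => (LinearMap.cancel_right (tensorTrivialMap_surjective hf)).1 h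

theorem modPRank_congr [Module.Finite ℤ M] [Module.Finite ℤ N] (e : M ≃ₗ[MonoidAlgebra ℤ G] N) :
    modPRank p G M = modPRank p G N :=
  (modPRank_le_of_surjective e.symm.toLinearMap e.symm.surjective).antisymm
    (modPRank_le_of_surjective e.toLinearMap e.surjective)

theorem modPRank_prod [Module.Finite ℤ M] [Module.Finite ℤ N] :
    modPRank p G (M × N) = modPRank p G M + modPRank p G N := by
  let e : (tensorTrivial G (M × N) →ₗ[ℤ] ZMod p) →ₗ[ZMod p]
      (tensorTrivial G M →ₗ[ℤ] ZMod p) × (tensorTrivial G N →ₗ[ℤ] ZMod p) :=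
    (LinearMap.lcomp (ZMod p) (ZMod p) (tensorTrivialMap (LinearMap.inl _ M N))).prod
      (LinearMap.lcomp (ZMod p) (ZMod p) (tensorTrivialMap (LinearMap.inr _ M N)))
  have he : Function.Bijective e := by
    constructor
    · intro a b h
      refine tensorTrivial_hom_ext fun x => ?_
      have h1 := LinearMap.congr_fun (congrArg Prod.fst h) (tensorTrivialMk x.1)
      have h2 := LinearMap.congr_fun (congrArg Prod.snd h) (tensorTrivialMk x.2)
      have hx : (tensorTrivialMk x : tensorTrivial G (M × N)) =
          tensorTrivialMk (x.1, 0) + tensorTrivialMk (0, x.2) := by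
        rw [← map_add]
        simp
      rw [hx, map_add, map_add]
      exact congrArg₂ (· + ·) h1 h2
    · rintro ⟨a, b⟩
      refine ⟨a ∘ₗ tensorTrivialMap (LinearMap.fst _ M N) +
        b ∘ₗ tensorTrivialMap (LinearMap.snd _ M N), ?_⟩
      refine Prod.ext (tensorTrivial_hom_ext fun x => ?_) (tensorTrivial_hom_ext fun x => ?_) <;>
      simp [e]
  exact (LinearEquiv.ofBijective e he).finrank_eq.trans Module.finrank_prod

theorem projective_tensorTrivial [Module.Projective (MonoidAlgebra ℤ G) M] :
    Module.Projective ℤ (tensorTrivial G M) := by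
  -- the augmentation identifies the coinvariants of a free module with a free abelian group
  let aug : (M →₀ MonoidAlgebra ℤ G) →ₗ[ℤ] (M →₀ ℤ) :=
    Finsupp.mapRange.linearMap (MonoidAlgebra.lift ℤ ℤ G 1).toLinearMap
  let augG : tensorTrivial G (M →₀ MonoidAlgebra ℤ G) →ₗ[ℤ] (M →₀ ℤ) :=
    tensorTrivialLift aug fun g x => by
      ext m
      simp [aug]
  let back : (M →₀ ℤ) →ₗ[ℤ] tensorTrivial G (M →₀ MonoidAlgebra ℤ G) :=
    Finsupp.lsum ℤ fun m => LinearMap.toSpanSingleton ℤ _ (tensorTrivialMk (Finsupp.single m 1))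
  have hback : back ∘ₗ augG = LinearMap.id := by
    refine tensorTrivial_hom_ext fun x => ?_
    change (back ∘ₗ aug) x = tensorTrivialMk x
    induction x using Finsupp.induction_linear with
    | zero => simp
    | add x y hx hy => rw [map_add, map_add, hx, hy]
    | single m a =>
      induction a using MonoidAlgebra.induction_linear with
      | zero => simp
      | add x y hx hy => rw [Finsupp.single_add, map_add, map_add, hx, hy]
      | single g n =>
        have h : (Finsupp.single m (MonoidAlgebra.single g n) : M →₀ MonoidAlgebra ℤ G) =
            n • MonoidAlgebra.of ℤ G g • Finsupp.single m 1 := by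
          simp
        rw [h, map_smul tensorTrivialMk n, tensorTrivialMk_of_smul, ← h]
        simp [back, aug]
  have : Module.Projective ℤ (tensorTrivial G (M →₀ MonoidAlgebra ℤ G)) := .of_split _ _ hback
  obtain ⟨s, hs⟩ := Module.Projective.out (R := MonoidAlgebra ℤ G) (P := M)
  refine .of_split (tensorTrivialMap s)
    (tensorTrivialMap (Finsupp.linearCombination (MonoidAlgebra ℤ G) id)) ?_
  rw [← tensorTrivialMap_comp, ← tensorTrivialMap_id]
  exact congrArg _ (LinearMap.ext hs)

/-- The coinvariants of a finitely generated projective module are a free abelian group, so their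
rank can be read off modulo `p`. -/
theorem modPRank_of_projective [Module.Finite (MonoidAlgebra ℤ G) M]
    [Module.Projective (MonoidAlgebra ℤ G) M] [Finite G] :
    modPRank p G M = Module.finrank ℤ (tensorTrivial G M) := by
  have := finite_int_of_finite_monoidAlgebra G M
  have : Module.Projective ℤ (tensorTrivial G M) := projective_tensorTrivial
  unfold modPRank
  rw [Module.finrank_linearMap, Module.finrank_self, mul_one]

end ModPRank

/-! ### Schanuel's lemma -/

/-- Schanuel's lemma for two projective presentations `A → P → M` and `B → Q → M` of a module:
the middle terms are interchangeable at the cost of the kernels. -/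
theorem nonempty_linearEquiv_of_exact {R : Type*} [Ring R] {A P B Q M : Type*}
    [AddCommGroup A] [Module R A] [AddCommGroup P] [Module R P] [AddCommGroup B] [Module R B]
    [AddCommGroup Q] [Module R Q] [AddCommGroup M] [Module R M]
    [Module.Projective R P] [Module.Projective R Q]
    {i : A →ₗ[R] P} {f : P →ₗ[R] M} {j : B →ₗ[R] Q} {g : Q →ₗ[R] M}
    (hi : Function.Injective i) (hif : Function.Exact i f) (hf : Function.Surjective f)
    (hj : Function.Injective j) (hjg : Function.Exact j g) (hg : Function.Surjective g) :
    Nonempty ((A × Q) ≃ₗ[R] (B × P)) := by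
  obtain ⟨u, hu⟩ := Module.projective_lifting_property g f hg
  obtain ⟨v, hv⟩ := Module.projective_lifting_property f g hf
  have hu (x : P) : g (u x) = f x := LinearMap.congr_fun hu x
  have hv (y : Q) : f (v y) = g y := LinearMap.congr_fun hv y
  -- both sides are identified with the fibre product of `P` and `Q` over `M`
  let α : A × Q →ₗ[R] P × Q := (i.coprod v).prod (LinearMap.snd R A Q)
  let β : B × P →ₗ[R] P × Q := (LinearMap.snd R B P).prod (j.coprod u)
  have hα : Function.Injective α := by
    rintro ⟨a, y⟩ ⟨a', y'⟩ h
    obtain ⟨h1, rfl⟩ := Prod.ext_iff.1 h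
    exact Prod.ext (hi (add_right_cancel h1)) rfl
  have hβ : Function.Injective β := by
    rintro ⟨b, x⟩ ⟨b', x'⟩ h
    obtain ⟨rfl, h2⟩ := Prod.ext_iff.1 h
    exact Prod.ext (hj (add_right_cancel h2)) rfl
  have hrα : LinearMap.range α = LinearMap.eqLocus (f ∘ₗ LinearMap.fst R P Q)
      (g ∘ₗ LinearMap.snd R P Q) := by
    ext ⟨x, y⟩
    constructor
    · rintro ⟨⟨a, y'⟩, h⟩
      obtain ⟨rfl, rfl⟩ := Prod.ext_iff.1 h
      simp [α, hif.apply_apply_eq_zero, hv]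
    · intro h
      have h : f x = g y := h
      obtain ⟨a, ha⟩ := (hif (x - v y)).1 (by rw [map_sub, hv, h, sub_self])
      exact ⟨(a, y), Prod.ext (by simp [α, ha]) rfl⟩
  have hrβ : LinearMap.range β = LinearMap.eqLocus (f ∘ₗ LinearMap.fst R P Q)
      (g ∘ₗ LinearMap.snd R P Q) := by
    ext ⟨x, y⟩
    constructor
    · rintro ⟨⟨b, x'⟩, h⟩
      obtain ⟨rfl, rfl⟩ := Prod.ext_iff.1 h
      simp [β, hjg.apply_apply_eq_zero, hu]
    · intro h
      have h : f x = g y := h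
      obtain ⟨b, hb⟩ := (hjg (y - u x)).1 (by rw [map_sub, hu, h, sub_self])
      exact ⟨(b, x), Prod.ext rfl (by simp [β, hb])⟩
  exact ⟨(LinearEquiv.ofInjective α hα).trans ((LinearEquiv.ofEq _ _ (hrα.trans hrβ.symm)).trans
    (LinearEquiv.ofInjective β hβ).symm)⟩

/-- Any resolution `P₂ → P₁ → P₀ → ℤ` has Euler characteristic at least `m(Ω) - q₁ + q₀`, where
`Ω` is the kernel of the first map of any given presentation `Q₁ → Q₀ → ℤ` by projectives and `m`
is the number of generators modulo `p`: by Schanuel's lemma the kernels of `P₁ → P₀` and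
`Q₁ → Q₀` are stably equivalent, and the former is a quotient of `P₂`. -/
theorem LengthThreeResolution.modPRank_ker_add_le {G : Type u} [Group G] [Finite G] (p : ℕ)
    [Fact p.Prime] (R : LengthThreeResolution G) {Q₁ Q₀ : Type*}
    [AddCommGroup Q₁] [Module (MonoidAlgebra ℤ G) Q₁] [AddCommGroup Q₀]
    [Module (MonoidAlgebra ℤ G) Q₀] [Module.Finite (MonoidAlgebra ℤ G) Q₁]
    [Module.Finite (MonoidAlgebra ℤ G) Q₀] [Module.Projective (MonoidAlgebra ℤ G) Q₁]
    [Module.Projective (MonoidAlgebra ℤ G) Q₀] (d : Q₁ →ₗ[MonoidAlgebra ℤ G] Q₀)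
    (η : Q₀ →ₗ[MonoidAlgebra ℤ G] (Representation.trivial ℤ G ℤ).asModule)
    (hη : Function.Surjective η) (hd : Function.Exact d η) :
    modPRank p G (LinearMap.ker d) + Module.finrank ℤ (tensorTrivial G R.P₁) +
        Module.finrank ℤ (tensorTrivial G Q₀) ≤
      Module.finrank ℤ (tensorTrivial G R.P₂) + Module.finrank ℤ (tensorTrivial G R.P₀) +
        Module.finrank ℤ (tensorTrivial G Q₁) := by
  have := R.finite₀
  have := R.finite₁
  have := R.finite₂
  have := R.projective₀
  have := R.projective₁
  have := R.projective₂
  have := finite_int_of_finite_monoidAlgebra G R.P₀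
  have := finite_int_of_finite_monoidAlgebra G R.P₁
  have := finite_int_of_finite_monoidAlgebra G R.P₂
  have := finite_int_of_finite_monoidAlgebra G Q₀
  have := finite_int_of_finite_monoidAlgebra G Q₁
  have : Module.Finite ℤ (LinearMap.ker d) :=
    .of_injective ((LinearMap.ker d).subtype.restrictScalars ℤ) Subtype.val_injective
  have : Module.Finite ℤ (LinearMap.ker R.d₁) :=
    .of_injective ((LinearMap.ker R.d₁).subtype.restrictScalars ℤ) Subtype.val_injective
  obtain ⟨e⟩ := nonempty_linearEquiv_of_exact (LinearMap.ker R.ε).injective_subtype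
    (LinearMap.exact_subtype_ker_map R.ε) R.surjective_ε (LinearMap.ker η).injective_subtype
    (LinearMap.exact_subtype_ker_map η) hη
  -- the maps `P₁ × Q₀ → ker ε × Q₀` and `Q₁ × P₀ → ker η × P₀`
  let f : R.P₁ × Q₀ →ₗ[MonoidAlgebra ℤ G] LinearMap.ker R.ε × Q₀ :=
    (R.d₁.codRestrict _ fun x => R.exact₀.apply_apply_eq_zero x).prodMap LinearMap.id
  let g : Q₁ × R.P₀ →ₗ[MonoidAlgebra ℤ G] LinearMap.ker η × R.P₀ :=
    (d.codRestrict _ fun x => hd.apply_apply_eq_zero x).prodMap LinearMap.id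
  have hf : Function.Surjective f := by
    rintro ⟨⟨x, hx⟩, y⟩
    obtain ⟨z, hz⟩ := (R.exact₀ x).1 hx
    exact ⟨(z, y), Prod.ext (Subtype.ext hz) rfl⟩
  have hg : Function.Surjective g := by
    rintro ⟨⟨x, hx⟩, y⟩
    obtain ⟨z, hz⟩ := (hd x).1 hx
    exact ⟨(z, y), Prod.ext (Subtype.ext hz) rfl⟩
  have hker : Function.Exact
      (LinearMap.inl _ R.P₁ Q₀ ∘ₗ (LinearMap.ker R.d₁).subtype) (e.toLinearMap ∘ₗ f) := by
    rintro ⟨x, y⟩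
    rw [LinearMap.comp_apply, LinearEquiv.coe_coe, map_eq_zero_iff e e.injective]
    constructor
    · intro h
      obtain ⟨h1, rfl⟩ := Prod.ext_iff.1 h
      exact ⟨⟨x, congrArg Subtype.val h1⟩, rfl⟩
    · rintro ⟨z, hz⟩
      obtain ⟨rfl, rfl⟩ := Prod.ext_iff.1 hz
      exact Prod.ext (Subtype.ext z.2) rfl
  have hker' : Function.Exact
      (LinearMap.inl _ Q₁ R.P₀ ∘ₗ (LinearMap.ker d).subtype) g := by
    rintro ⟨x, y⟩
    constructor
    · intro h
      obtain ⟨h1, rfl⟩ := Prod.ext_iff.1 h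
      exact ⟨⟨x, congrArg Subtype.val h1⟩, rfl⟩
    · rintro ⟨z, hz⟩
      obtain ⟨rfl, rfl⟩ := Prod.ext_iff.1 hz
      exact Prod.ext (Subtype.ext z.2) rfl
  obtain ⟨e'⟩ := nonempty_linearEquiv_of_exact
    (LinearMap.inl_injective.comp (LinearMap.ker R.d₁).injective_subtype) hker
    (e.surjective.comp hf) (LinearMap.inl_injective.comp (LinearMap.ker d).injective_subtype)
    hker' hg
  have h := modPRank_congr (p := p) e'
  rw [modPRank_prod, modPRank_prod, modPRank_prod, modPRank_prod,
    modPRank_of_projective (M := R.P₁), modPRank_of_projective (M := R.P₀),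
    modPRank_of_projective (M := Q₁), modPRank_of_projective (M := Q₀)] at h
  have hle : modPRank p G (LinearMap.ker R.d₁) ≤ Module.finrank ℤ (tensorTrivial G R.P₂) := by
    rw [← modPRank_of_projective (p := p) (M := R.P₂)]
    refine modPRank_le_of_surjective
      (R.d₂.codRestrict _ fun x => R.exact₁.apply_apply_eq_zero x) ?_
    rintro ⟨x, hx⟩
    obtain ⟨z, hz⟩ := (R.exact₁ x).1 hx
    exact ⟨z, Subtype.ext hz⟩
  omega

/-! ### The augmentation -/

section Augmentation

variable (G : Type*) [Group G]

/-- The augmentation `ℤ[G] → ℤ`, which sends every group element to one. -/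
def groupRingAug : MonoidAlgebra ℤ G →ₐ[ℤ] ℤ := MonoidAlgebra.lift ℤ ℤ G 1

@[simp]
theorem groupRingAug_single (g : G) (n : ℤ) :
    groupRingAug G (MonoidAlgebra.single g n) = n := by
  simp [groupRingAug]

variable {G}

theorem tensorTrivialMk_smul {M : Type*} [AddCommGroup M] [Module (MonoidAlgebra ℤ G) M]
    (r : MonoidAlgebra ℤ G) (x : M) :
    (tensorTrivialMk (r • x) : tensorTrivial G M) = groupRingAug G r • tensorTrivialMk x := by
  induction r using MonoidAlgebra.induction_linear with
  | zero => simp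
  | add a b ha hb => rw [add_smul, map_add, map_add, ha, hb, add_smul]
  | single g n =>
    have h : (MonoidAlgebra.single g n : MonoidAlgebra ℤ G) • x =
        n • MonoidAlgebra.of ℤ G g • x := by
      rw [← smul_assoc]
      simp
    rw [h, map_smul tensorTrivialMk n, tensorTrivialMk_of_smul, groupRingAug_single]

theorem asModuleEquiv_trivial_smul (r : MonoidAlgebra ℤ G)
    (x : (Representation.trivial ℤ G ℤ).asModule) :
    (Representation.trivial ℤ G ℤ).asModuleEquiv (r • x) =
      groupRingAug G r * (Representation.trivial ℤ G ℤ).asModuleEquiv x := by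
  rw [Representation.asModuleEquiv_map_smul]
  induction r using MonoidAlgebra.induction_linear with
  | zero => simp
  | add a b ha hb => rw [map_add, LinearMap.add_apply, ha, hb, map_add, add_mul]
  | single g n => simp [Representation.asAlgebraHom_single]

variable (G) in
/-- The augmentation as a map of `ℤ[G]`-modules onto the trivial module. -/
def groupRingAugModule :
    MonoidAlgebra ℤ G →ₗ[MonoidAlgebra ℤ G] (Representation.trivial ℤ G ℤ).asModule :=
  LinearMap.toSpanSingleton _ _ ((Representation.trivial ℤ G ℤ).asModuleEquiv.symm 1)

theorem asModuleEquiv_groupRingAugModule (r : MonoidAlgebra ℤ G) :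
    (Representation.trivial ℤ G ℤ).asModuleEquiv (groupRingAugModule G r) = groupRingAug G r := by
  rw [groupRingAugModule, LinearMap.toSpanSingleton_apply, asModuleEquiv_trivial_smul]
  simp

theorem groupRingAugModule_eq_zero_iff (r : MonoidAlgebra ℤ G) :
    groupRingAugModule G r = 0 ↔ groupRingAug G r = 0 := by
  rw [← asModuleEquiv_groupRingAugModule, LinearEquiv.map_eq_zero_iff]

theorem groupRingAugModule_surjective : Function.Surjective (groupRingAugModule G) := by
  intro x
  refine ⟨MonoidAlgebra.single 1 ((Representation.trivial ℤ G ℤ).asModuleEquiv x), ?_⟩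
  apply (Representation.trivial ℤ G ℤ).asModuleEquiv.injective
  rw [asModuleEquiv_groupRingAugModule, groupRingAug_single]

variable (G) in
theorem finrank_tensorTrivial_groupRing :
    Module.finrank ℤ (tensorTrivial G (MonoidAlgebra ℤ G)) = 1 := by
  let e : tensorTrivial G (MonoidAlgebra ℤ G) →ₗ[ℤ] ℤ :=
    tensorTrivialLift (groupRingAug G).toLinearMap fun g x => by simp
  have he : Function.Bijective e := by
    constructor
    · rw [← LinearMap.ker_eq_bot, LinearMap.ker_eq_bot']
      intro x hx
      obtain ⟨x, rfl⟩ := tensorTrivialMk_surjective x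
      have hx : groupRingAug G x = 0 := hx
      rw [← mul_one x, ← smul_eq_mul, tensorTrivialMk_smul, hx, zero_smul]
    · intro n
      exact ⟨tensorTrivialMk (MonoidAlgebra.single 1 n), groupRingAug_single G 1 n⟩
  rw [(LinearEquiv.ofBijective e he).finrank_eq, Module.finrank_self]

theorem finrank_tensorTrivial_prod [Finite G] {M N : Type u} [AddCommGroup M]
    [Module (MonoidAlgebra ℤ G) M] [AddCommGroup N] [Module (MonoidAlgebra ℤ G) N]
    [Module.Finite ℤ M] [Module.Finite ℤ N] :
    Module.finrank ℤ (tensorTrivial G (M × N)) =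
      Module.finrank ℤ (tensorTrivial G M) + Module.finrank ℤ (tensorTrivial G N) :=
  finrank_tensorTrivial_of_exact LinearMap.inl_injective
    (f := LinearMap.inl (MonoidAlgebra ℤ G) M N) .inl_snd LinearMap.snd_surjective

end Augmentation

/-! ### The group ring of `ℤ_p ⊕ ℤ_p` -/

section GroupRing

variable {p : ℕ} [Fact p.Prime]

variable (p) in
/-- The group element `x ^ i * y ^ j` of `ℤ_p ⊕ ℤ_p` in the group ring. -/
def grpElt (i j : ZMod p) : MonoidAlgebra ℤ (ZpZp p) :=
  MonoidAlgebra.single (Multiplicative.ofAdd (i, j)) 1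

theorem grpElt_mul (i j i' j' : ZMod p) :
    grpElt p i j * grpElt p i' j' = grpElt p (i + i') (j + j') := by
  simp [grpElt, ← ofAdd_add]

theorem grpElt_pow (i j : ZMod p) (n : ℕ) : grpElt p i j ^ n = grpElt p (n * i) (n * j) := by
  simp [grpElt, MonoidAlgebra.single_pow, ← ofAdd_nsmul]

variable (p) in
/-- The norm element `1 + x + ⋯ + x ^ (p - 1)`. -/
def normX : MonoidAlgebra ℤ (ZpZp p) := ∑ i : ZMod p, grpElt p i 0

variable (p) in
/-- The norm element `1 + y + ⋯ + y ^ (p - 1)`. -/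
def normY : MonoidAlgebra ℤ (ZpZp p) := ∑ j : ZMod p, grpElt p 0 j

/-- The coefficient of `x ^ i * y ^ j`. -/
def grpCoeff (a : MonoidAlgebra ℤ (ZpZp p)) (i j : ZMod p) : ℤ :=
  a.coeff (Multiplicative.ofAdd (i, j))

theorem eq_sum_grpCoeff (a : MonoidAlgebra ℤ (ZpZp p)) :
    a = ∑ i : ZMod p, ∑ j : ZMod p, grpCoeff a i j • grpElt p i j := by
  conv_lhs => rw [← MonoidAlgebra.sum_coeff_single a, Finsupp.sum_fintype _ _ (by simp),
    ← Multiplicative.ofAdd.sum_comp, Fintype.sum_prod_type]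
  simp [grpElt, grpCoeff]

theorem grpCoeff_mul_grpElt (a : MonoidAlgebra ℤ (ZpZp p)) (i j s t : ZMod p) :
    grpCoeff (a * grpElt p s t) i j = grpCoeff a (i - s) (j - t) := by
  rw [grpCoeff, grpElt, MonoidAlgebra.coeff_mul_single_apply, mul_one,
    ← div_eq_mul_inv, ← ofAdd_sub]
  rfl

theorem groupRingAug_grpElt (i j : ZMod p) : groupRingAug _ (grpElt p i j) = 1 :=
  groupRingAug_single _ _ _

theorem sub_one_dvd_grpElt_right (j : ZMod p) : grpElt p 0 1 - 1 ∣ grpElt p 0 j - 1 := by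
  have h := sub_dvd_pow_sub_pow (grpElt p 0 1) 1 j.val
  simpa [grpElt_pow] using h

theorem sub_one_dvd_grpElt_left (i : ZMod p) : grpElt p 1 0 - 1 ∣ grpElt p i 0 - 1 := by
  have h := sub_dvd_pow_sub_pow (grpElt p 1 0) 1 i.val
  simpa [grpElt_pow] using h

theorem grpCoeff_eq_of_mul_right {b : MonoidAlgebra ℤ (ZpZp p)} (h : b * (grpElt p 0 1 - 1) = 0)
    (i j : ZMod p) : grpCoeff b i j = grpCoeff b i 0 := by
  have h : b * grpElt p 0 1 = b := by linear_combination h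
  have hn (n : ℕ) : grpCoeff b i n = grpCoeff b i 0 := by
    induction n with
    | zero => simp
    | succ n ih => rw [← h, grpCoeff_mul_grpElt]; simpa [h] using ih
  simpa using hn j.val

theorem grpCoeff_eq_of_mul_left {b : MonoidAlgebra ℤ (ZpZp p)} (h : b * (grpElt p 1 0 - 1) = 0)
    (i j : ZMod p) : grpCoeff b i j = grpCoeff b 0 j := by
  have h : b * grpElt p 1 0 = b := by linear_combination h
  have hn (n : ℕ) : grpCoeff b n j = grpCoeff b 0 j := by
    induction n with
    | zero => simp
    | succ n ih => rw [← h, grpCoeff_mul_grpElt]; simpa [h] using ih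
  simpa using hn i.val

theorem normX_mul : normX p * (grpElt p 1 0 - 1) = 0 := by
  rw [mul_sub, mul_one, sub_eq_zero, normX, Finset.sum_mul]
  simp only [grpElt_mul]
  exact Fintype.sum_equiv (Equiv.addRight 1) _ _ fun i => by simp

theorem normY_mul : normY p * (grpElt p 0 1 - 1) = 0 := by
  rw [mul_sub, mul_one, sub_eq_zero, normY, Finset.sum_mul]
  simp only [grpElt_mul]
  exact Fintype.sum_equiv (Equiv.addRight 1) _ _ fun i => by simp

theorem exists_eq_mul_normY {b : MonoidAlgebra ℤ (ZpZp p)} (h : b * (grpElt p 0 1 - 1) = 0) :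
    ∃ d, b = d * normY p := by
  refine ⟨∑ i : ZMod p, grpCoeff b i 0 • grpElt p i 0, ?_⟩
  conv_lhs => rw [eq_sum_grpCoeff b]
  simp only [normY, Finset.sum_mul, Finset.mul_sum, smul_mul_assoc, grpElt_mul,
    grpCoeff_eq_of_mul_right h, add_zero, zero_add]
  exact Finset.sum_comm

theorem eq_normX_mul_normY {c : MonoidAlgebra ℤ (ZpZp p)} (hx : c * (grpElt p 1 0 - 1) = 0)
    (hy : c * (grpElt p 0 1 - 1) = 0) : c = grpCoeff c 0 0 • (normX p * normY p) := by
  conv_lhs => rw [eq_sum_grpCoeff c]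
  simp only [normX, normY, Finset.sum_mul, Finset.mul_sum, grpElt_mul, Finset.smul_sum,
    grpCoeff_eq_of_mul_right hy, add_zero, zero_add]
  simp only [grpCoeff_eq_of_mul_left hx]
  exact Finset.sum_comm

theorem sub_one_dvd_of_mul_normY {a : MonoidAlgebra ℤ (ZpZp p)} (h : a * normY p = 0) :
    grpElt p 0 1 - 1 ∣ a := by
  have hrow (i : ZMod p) : ∑ j : ZMod p, grpCoeff a i j = 0 := by
    have h0 : grpCoeff (a * normY p) i 0 = 0 := by rw [h]; rfl
    rw [normY, Finset.mul_sum] at h0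
    have h1 : ∑ j : ZMod p, grpCoeff (a * grpElt p 0 j) i 0 = 0 := by
      rw [← h0]
      simp only [grpCoeff, MonoidAlgebra.coeff_sum, Finsupp.finsetSum_apply]
    simp only [grpCoeff_mul_grpElt, sub_zero, zero_sub] at h1
    rw [← h1]
    exact Fintype.sum_equiv (Equiv.neg _) _ _ fun j => by simp
  have ha : a = ∑ i : ZMod p, ∑ j : ZMod p,
      grpCoeff a i j • (grpElt p i 0 * (grpElt p 0 j - 1)) := by
    conv_lhs => rw [eq_sum_grpCoeff a]
    simp only [mul_sub, mul_one, grpElt_mul, add_zero, zero_add, smul_sub, Finset.sum_sub_distrib,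
      ← Finset.sum_smul, hrow, zero_smul, sub_zero]
  rw [ha]
  exact Finset.dvd_sum fun i _ => Finset.dvd_sum fun j _ => by
    rw [zsmul_eq_mul, ← mul_assoc]
    exact (sub_one_dvd_grpElt_right j).mul_left _

theorem exists_of_groupRingAug_eq_zero {a : MonoidAlgebra ℤ (ZpZp p)}
    (h : groupRingAug _ a = 0) :
    ∃ c d, c * (grpElt p 1 0 - 1) + d * (grpElt p 0 1 - 1) = a := by
  rw [← Ideal.mem_span_pair]
  have hsum : ∑ i : ZMod p, ∑ j : ZMod p, grpCoeff a i j = 0 := by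
    rw [← h]
    conv_rhs => rw [eq_sum_grpCoeff a]
    simp [groupRingAug_grpElt]
  have ha : a = ∑ i : ZMod p, ∑ j : ZMod p,
      grpCoeff a i j • (grpElt p i 0 * (grpElt p 0 j - 1) + (grpElt p i 0 - 1)) := by
    conv_lhs => rw [eq_sum_grpCoeff a]
    simp only [mul_sub, mul_one, grpElt_mul, add_zero, zero_add, smul_sub, Finset.sum_sub_distrib,
      ← Finset.sum_smul, hsum, zero_smul, sub_zero, sub_add_sub_cancel]
  rw [ha]
  refine Ideal.sum_mem _ fun i _ => Ideal.sum_mem _ fun j _ => zsmul_mem (add_mem ?_ ?_) _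
  · exact Ideal.mul_mem_left _ _ (Ideal.mem_of_dvd _ (sub_one_dvd_grpElt_right j)
      (Ideal.subset_span (by simp)))
  · exact Ideal.mem_of_dvd _ (sub_one_dvd_grpElt_left i) (Ideal.subset_span (by simp))

/-! ### The standard resolution -/

variable (p) in
/-- The boundary map of the 1-cells of the standard presentation. -/
def stdD₁ : MonoidAlgebra ℤ (ZpZp p) × MonoidAlgebra ℤ (ZpZp p) →ₗ[MonoidAlgebra ℤ (ZpZp p)]
    MonoidAlgebra ℤ (ZpZp p) :=
  (LinearMap.toSpanSingleton _ _ (grpElt p 1 0 - 1)).coprod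
    (LinearMap.toSpanSingleton _ _ (grpElt p 0 1 - 1))

variable (p) in
/-- The boundary map of the 2-cells of the standard presentation, given by the Fox derivatives of
the relators `x ^ p`, `y ^ p` and `[x, y]`; the sign of the last one is reversed. -/
def stdD₂ : MonoidAlgebra ℤ (ZpZp p) × MonoidAlgebra ℤ (ZpZp p) × MonoidAlgebra ℤ (ZpZp p)
    →ₗ[MonoidAlgebra ℤ (ZpZp p)] MonoidAlgebra ℤ (ZpZp p) × MonoidAlgebra ℤ (ZpZp p) :=
  (LinearMap.toSpanSingleton _ _ (normX p, 0)).coprod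
    ((LinearMap.toSpanSingleton _ _ (0, normY p)).coprod
      (LinearMap.toSpanSingleton _ _ (grpElt p 0 1 - 1, -(grpElt p 1 0 - 1))))

theorem stdD₁_apply (z : MonoidAlgebra ℤ (ZpZp p) × MonoidAlgebra ℤ (ZpZp p)) :
    stdD₁ p z = z.1 * (grpElt p 1 0 - 1) + z.2 * (grpElt p 0 1 - 1) := rfl

theorem stdD₂_apply (z : MonoidAlgebra ℤ (ZpZp p) × MonoidAlgebra ℤ (ZpZp p) ×
    MonoidAlgebra ℤ (ZpZp p)) :
    stdD₂ p z = (z.1 * normX p + z.2.2 * (grpElt p 0 1 - 1),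
      z.2.1 * normY p - z.2.2 * (grpElt p 1 0 - 1)) := by
  refine Prod.ext (by simp [stdD₂]) ?_
  simp only [stdD₂, LinearMap.coprod_apply, LinearMap.toSpanSingleton_apply, Prod.snd_add,
    Prod.smul_snd, smul_eq_mul]
  ring

theorem exact_stdD₁ : Function.Exact (stdD₁ p) (groupRingAugModule (ZpZp p)) := by
  intro a
  rw [groupRingAugModule_eq_zero_iff]
  constructor
  · intro h
    obtain ⟨c, d, h⟩ := exists_of_groupRingAug_eq_zero h
    exact ⟨(c, d), h⟩
  · rintro ⟨z, rfl⟩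
    simp [stdD₁_apply, groupRingAug_grpElt]

theorem exact_stdD₂ : Function.Exact (stdD₂ p) (stdD₁ p) := by
  rintro ⟨a, b⟩
  constructor
  · intro h
    have h : a * (grpElt p 1 0 - 1) + b * (grpElt p 0 1 - 1) = 0 := h
    -- `a * normY` is invariant under the group, hence a multiple of `normX * normY`
    have hc := eq_normX_mul_normY (c := a * normY p)
      (by linear_combination normY p * h - b * normY_mul (p := p))
      (by linear_combination a * normY_mul (p := p))
    set n := grpCoeff (a * normY p) 0 0
    obtain ⟨k, hk⟩ := sub_one_dvd_of_mul_normY (a := a - n • normX p) (by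
      rw [sub_mul, hc, smul_mul_assoc, sub_self])
    obtain ⟨d, hd⟩ := exists_eq_mul_normY (b := b + k * (grpElt p 1 0 - 1)) (by
      have hx := congrArg (n • ·) (normX_mul (p := p))
      simp only [zsmul_eq_mul, mul_zero] at hx hk
      linear_combination h - (grpElt p 1 0 - 1) * hk - hx)
    refine ⟨((n : MonoidAlgebra ℤ (ZpZp p)), d, k), ?_⟩
    rw [stdD₂_apply]
    rw [zsmul_eq_mul] at hk
    exact Prod.ext (by linear_combination -hk) (by linear_combination -hd)
  · rintro ⟨z, hz⟩
    rw [← hz, stdD₁_apply, stdD₂_apply]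
    linear_combination z.1 * normX_mul (p := p) + z.2.1 * normY_mul (p := p)

/-- The ring homomorphism from the group ring to the dual numbers over `ℤ_p` that sends
`x ^ i * y ^ j` to `1 + j ε`. -/
def toDualNumber : MonoidAlgebra ℤ (ZpZp p) →ₐ[ℤ] DualNumber (ZMod p) :=
  MonoidAlgebra.lift ℤ _ _
    { toFun := fun g => TrivSqZeroExt.inl 1 + TrivSqZeroExt.inr g.toAdd.2
      map_one' := by simp
      map_mul' := fun g h => by ext <;> simp [add_comm] }

theorem toDualNumber_grpElt (i j : ZMod p) :
    toDualNumber (grpElt p i j) = TrivSqZeroExt.inl 1 + TrivSqZeroExt.inr j := by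
  simp [toDualNumber, grpElt]

theorem fst_toDualNumber (a : MonoidAlgebra ℤ (ZpZp p)) :
    (toDualNumber a).fst = (groupRingAug _ a : ZMod p) := by
  induction a using MonoidAlgebra.induction_linear with
  | zero => simp
  | add a b ha hb => simp [ha, hb]
  | single g n => simp [toDualNumber]

/-- The relations between the three generators of the kernel of `stdD₁` have coefficients whose
augmentations vanish modulo `p`. -/
theorem groupRingAug_eq_zero_of_stdD₂ {z : MonoidAlgebra ℤ (ZpZp p) × MonoidAlgebra ℤ (ZpZp p) ×
    MonoidAlgebra ℤ (ZpZp p)} (hz : stdD₂ p z = 0) :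
    (groupRingAug _ z.1 : ZMod p) = 0 ∧ (groupRingAug _ z.2.1 : ZMod p) = 0 ∧
      (groupRingAug _ z.2.2 : ZMod p) = 0 := by
  rw [stdD₂_apply, Prod.mk_eq_zero] at hz
  obtain ⟨h1, h2⟩ := hz
  have hp : (p : ℤ) ≠ 0 := by exact_mod_cast (Fact.out : p.Prime).ne_zero
  refine ⟨?_, ?_, ?_⟩
  · have h := congrArg (groupRingAug _) h1
    simp [normX, groupRingAug_grpElt, (Fact.out : p.Prime).ne_zero] at h
    simp [h]
  · have h := congrArg (groupRingAug _) h2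
    simp [normY, groupRingAug_grpElt, (Fact.out : p.Prime).ne_zero] at h
    simp [h]
  · have h := congrArg (fun a => (toDualNumber a).snd) h1
    simpa [normX, toDualNumber_grpElt, fst_toDualNumber] using h

/-- The kernel of `stdD₁` needs three generators modulo `p`: the three coefficients of an element,
augmented and reduced modulo `p`, do not depend on the way it is written in terms of the generators
provided by `stdD₂`. -/
theorem three_le_modPRank_ker_stdD₁ : 3 ≤ modPRank p (ZpZp p) (LinearMap.ker (stdD₁ p)) := by
  let R := MonoidAlgebra ℤ (ZpZp p)
  have : Module.Finite ℤ (LinearMap.ker (stdD₁ p)) :=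
    .of_injective ((LinearMap.ker (stdD₁ p)).subtype.restrictScalars ℤ) Subtype.val_injective
  have h3 : modPRank p (ZpZp p) (R × R × R) = 3 := by
    rw [modPRank_of_projective, finrank_tensorTrivial_prod, finrank_tensorTrivial_prod,
      finrank_tensorTrivial_groupRing]
  rw [← h3]
  let d : R × R × R →ₗ[R] LinearMap.ker (stdD₁ p) :=
    (stdD₂ p).codRestrict _ fun z => exact_stdD₂.apply_apply_eq_zero z
  have hd : Function.Surjective d := by
    rintro ⟨z, hz⟩
    obtain ⟨w, hw⟩ := (exact_stdD₂ z).1 hz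
    exact ⟨w, Subtype.ext hw⟩
  refine LinearMap.finrank_le_finrank_of_surjective (f := LinearMap.lcomp (ZMod p) (ZMod p)
    (tensorTrivialMap d)) fun ψ => ?_
  have hker : LinearMap.ker (tensorTrivialMap d) ≤ LinearMap.ker ψ := by
    rw [ker_tensorTrivialMap_eq (LinearMap.exact_subtype_ker_map d) hd]
    rintro _ ⟨z, rfl⟩
    obtain ⟨⟨z, hz⟩, rfl⟩ := tensorTrivialMk_surjective z
    obtain ⟨h1, h2, h3⟩ := groupRingAug_eq_zero_of_stdD₂ (congrArg Subtype.val hz)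
    have hz' : z = z.1 • (1, 0, 0) + (z.2.1 • (0, 1, 0) + z.2.2 • (0, 0, 1)) := by
      simp [Prod.ext_iff]
    change ψ (tensorTrivialMk z) = 0
    rw [hz']
    have key (r : R) (x : R × R × R) (hr : (groupRingAug _ r : ZMod p) = 0) :
        ψ (tensorTrivialMk (r • x)) = 0 := by
      rw [tensorTrivialMk_smul, map_zsmul, zsmul_eq_mul, hr, zero_mul]
    rw [map_add, map_add, map_add, map_add, key _ _ h1, key _ _ h2, key _ _ h3, add_zero, add_zero]
  refine ⟨(LinearMap.ker (tensorTrivialMap d)).liftQ ψ hker ∘ₗ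
    ((tensorTrivialMap d).quotKerEquivOfSurjective
      (tensorTrivialMap_surjective hd)).symm.toLinearMap, LinearMap.ext fun x => ?_⟩
  have hx : ((tensorTrivialMap d).quotKerEquivOfSurjective
      (tensorTrivialMap_surjective hd)).symm (tensorTrivialMap d x) = Submodule.Quotient.mk x := by
    rw [LinearEquiv.symm_apply_eq]
    rfl
  simp [hx]

variable (p) in
/-- The cellular chain complex of the universal cover of the standard presentation complex. -/
def stdResolution : LengthThreeResolution (ZpZp p) where
  P₀ := .of _ (MonoidAlgebra ℤ (ZpZp p))
  P₁ := .of _ (MonoidAlgebra ℤ (ZpZp p) × MonoidAlgebra ℤ (ZpZp p))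
  P₂ := .of _ (MonoidAlgebra ℤ (ZpZp p) × MonoidAlgebra ℤ (ZpZp p) × MonoidAlgebra ℤ (ZpZp p))
  finite₀ := inferInstance
  finite₁ := inferInstance
  finite₂ := inferInstance
  projective₀ := inferInstance
  projective₁ := inferInstance
  projective₂ := inferInstance
  ε := groupRingAugModule _
  d₁ := stdD₁ p
  d₂ := stdD₂ p
  surjective_ε := groupRingAugModule_surjective
  exact₀ := exact_stdD₁
  exact₁ := exact_stdD₂

theorem finrank_stdResolution_Omega :
    Module.finrank ℤ (tensorTrivial (ZpZp p) (stdResolution p).Omega) = 1 := by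
  have h := (stdResolution p).finrank_Omega
  have h0 : Module.finrank ℤ (tensorTrivial (ZpZp p) (stdResolution p).P₀) = 1 :=
    finrank_tensorTrivial_groupRing (ZpZp p)
  have h1 : Module.finrank ℤ (tensorTrivial (ZpZp p) (stdResolution p).P₁) = 2 := by
    refine finrank_tensorTrivial_prod.trans ?_
    rw [finrank_tensorTrivial_groupRing]
  have h2 : Module.finrank ℤ (tensorTrivial (ZpZp p) (stdResolution p).P₂) = 3 := by
    refine finrank_tensorTrivial_prod.trans ?_
    rw [finrank_tensorTrivial_prod, finrank_tensorTrivial_groupRing]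
  omega

/-- The Euler characteristic of a resolution is at least that of the standard presentation. -/
theorem one_le_finrank_Omega (R : LengthThreeResolution (ZpZp p)) :
    1 ≤ Module.finrank ℤ (tensorTrivial (ZpZp p) R.Omega) := by
  have h1 := R.finrank_Omega
  have h2 := R.modPRank_ker_add_le p (stdD₁ p) (groupRingAugModule _)
    groupRingAugModule_surjective exact_stdD₁
  have h3 := three_le_modPRank_ker_stdD₁ (p := p)
  rw [finrank_tensorTrivial_prod, finrank_tensorTrivial_groupRing] at h2
  omega

variable (p) in
theorem hambletonKreckD_ZpZp : hambletonKreckD (ZpZp p) = 1 := by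
  refine IsLeast.csInf_eq ⟨⟨stdResolution p, finrank_stdResolution_Omega.symm⟩, ?_⟩
  rintro n ⟨R, rfl⟩
  exact one_le_finrank_Omega R

end GroupRing

/-! ### Homomorphisms out of `ℤ_p ⊕ ℤ_p` -/

section ZpZpHom

variable {p : ℕ} [Fact p.Prime]

variable (p) in
/-- The first generator of `ℤ_p ⊕ ℤ_p`. -/
def genX : ZpZp p := Multiplicative.ofAdd (1, 0)

variable (p) in
/-- The second generator of `ℤ_p ⊕ ℤ_p`. -/
def genY : ZpZp p := Multiplicative.ofAdd (0, 1)

theorem genX_pow (n : ℕ) : genX p ^ n = Multiplicative.ofAdd ((n : ZMod p), 0) := by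
  simp [genX, ← ofAdd_nsmul]

theorem genY_pow (n : ℕ) : genY p ^ n = Multiplicative.ofAdd (0, (n : ZMod p)) := by
  simp [genY, ← ofAdd_nsmul]

theorem genX_pow_mul_genY_pow (g : ZpZp p) :
    genX p ^ g.toAdd.1.val * genY p ^ g.toAdd.2.val = g := by
  rw [genX_pow, genY_pow, ← ofAdd_add]
  simp

/-- Two commuting elements of exponent `p` define a homomorphism out of `ℤ_p ⊕ ℤ_p`. -/
theorem exists_zpZpHom {E : Type*} [Group E] {X Y : E} (hX : X ^ p = 1) (hY : Y ^ p = 1)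
    (hXY : Commute X Y) :
    ∃ s : ZpZp p →* E, ∀ g, s g = X ^ g.toAdd.1.val * Y ^ g.toAdd.2.val := by
  let lift (Z : E) (hZ : Z ^ p = 1) : ZMod p →+ Additive E :=
    ZMod.lift p ⟨zmultiplesHom _ (Additive.ofMul Z), by simpa [← ofMul_pow] using hZ⟩
  have hlift (Z : E) (hZ : Z ^ p = 1) (i : ZMod p) : lift Z hZ i = Additive.ofMul (Z ^ i.val) := by
    have h : lift Z hZ (i.val : ℤ) = (i.val : ℤ) • Additive.ofMul Z := ZMod.lift_coe p _ _
    rwa [Int.cast_natCast, ZMod.natCast_zmod_val, natCast_zsmul, ← ofMul_pow] at h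
  refine ⟨AddMonoidHom.toMultiplicativeLeft (AddMonoidHom.noncommCoprod (lift X hX) (lift Y hY)
    fun i j => ?_), fun g => ?_⟩
  · rw [hlift X hX, hlift Y hY]
    exact hXY.pow_pow _ _
  · change Additive.toMul (lift X hX _ + lift Y hY _) = _
    rw [hlift X hX, hlift Y hY]
    rfl

end ZpZpHom

/-! ### Extensions defined by 2-cocycles -/

section CocycleExtension

variable {G A : Type*} [Group G] [AddCommGroup A]

/-- The cocycle identity for functions of two variables on `G` with values in the trivial module
`A`. -/
def IsTrivialCocycle (φ : G → G → A) : Prop :=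
  ∀ g h k, φ h k + φ g (h * k) = φ (g * h) k + φ g h

/-- The central extension of `G` by `A` defined by a 2-cocycle `φ`, with underlying set `A × G`.
The cocycle is not normalised, so that the unit is `(-φ 1 1, 1)`. -/
@[ext]
structure CocycleExtension (φ : G → G → A) (hφ : IsTrivialCocycle φ) where
  fiber : A
  proj : G

namespace CocycleExtension

variable {φ : G → G → A} {hφ : IsTrivialCocycle φ}

instance : Mul (CocycleExtension φ hφ) where
  mul a b := ⟨a.fiber + b.fiber + φ a.proj b.proj, a.proj * b.proj⟩

instance : One (CocycleExtension φ hφ) where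
  one := ⟨-φ 1 1, 1⟩

instance : Inv (CocycleExtension φ hφ) where
  inv a := ⟨-a.fiber - φ a.proj⁻¹ a.proj - φ 1 1, a.proj⁻¹⟩

@[simp]
theorem mul_fiber (a b : CocycleExtension φ hφ) :
    (a * b).fiber = a.fiber + b.fiber + φ a.proj b.proj := rfl

@[simp]
theorem mul_proj (a b : CocycleExtension φ hφ) : (a * b).proj = a.proj * b.proj := rfl

@[simp]
theorem one_fiber : (1 : CocycleExtension φ hφ).fiber = -φ 1 1 := rfl

@[simp]
theorem one_proj : (1 : CocycleExtension φ hφ).proj = 1 := rfl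

@[simp]
theorem inv_fiber (a : CocycleExtension φ hφ) :
    a⁻¹.fiber = -a.fiber - φ a.proj⁻¹ a.proj - φ 1 1 := rfl

@[simp]
theorem inv_proj (a : CocycleExtension φ hφ) : a⁻¹.proj = a.proj⁻¹ := rfl

instance : Group (CocycleExtension φ hφ) :=
  Group.ofLeftAxioms
    (fun a b c => by
      ext
      · have := hφ a.proj b.proj c.proj
        simp only [mul_fiber, mul_proj]
        grind
      · exact mul_assoc _ _ _)
    (fun a => by
      ext
      · have := hφ 1 1 a.proj
        simp only [one_mul, add_right_inj] at this
        simp [this]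
      · exact one_mul _)
    (fun a => by
      ext
      · simp only [mul_fiber, inv_fiber, inv_proj, one_fiber]
        abel
      · exact inv_mul_cancel _)

@[simp]
theorem pow_proj (a : CocycleExtension φ hφ) (n : ℕ) : (a ^ n).proj = a.proj ^ n := by
  induction n with
  | zero => simp
  | succ n ih => simp [pow_succ, ih]

theorem pow_fiber (x : G) (n : ℕ) :
    ((⟨0, x⟩ : CocycleExtension φ hφ) ^ n).fiber = -φ 1 1 + ∑ i ∈ Finset.range n, φ (x ^ i) x := by
  induction n with
  | zero => simp
  | succ n ih => simp [pow_succ, ih, Finset.sum_range_succ, add_assoc]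

end CocycleExtension

/-- A 2-cocycle on `ℤ_p ⊕ ℤ_p` is a coboundary as soon as the relators `x ^ p`, `y ^ p`, `[x, y]`
hold in the corresponding extension, for the obvious lifts of the generators. -/
theorem exists_coboundary_of_relators {p : ℕ} [Fact p.Prime] {φ : ZpZp p → ZpZp p → A}
    (hφ : IsTrivialCocycle φ) (hX : ∑ i ∈ Finset.range p, φ (genX p ^ i) (genX p) = 0)
    (hY : ∑ i ∈ Finset.range p, φ (genY p ^ i) (genY p) = 0)
    (hXY : φ (genX p) (genY p) = φ (genY p) (genX p)) :
    ∃ ψ : ZpZp p → A, ∀ g h, φ g h = ψ (g * h) - ψ g - ψ h := by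
  let X : CocycleExtension φ hφ := ⟨0, genX p⟩
  let Y : CocycleExtension φ hφ := ⟨0, genY p⟩
  have h1 : X ^ p = 1 := by
    refine CocycleExtension.ext ?_ ?_
    · rw [CocycleExtension.pow_fiber, hX, add_zero, CocycleExtension.one_fiber]
    · simp [X, genX_pow]
  have h2 : Y ^ p = 1 := by
    refine CocycleExtension.ext ?_ ?_
    · rw [CocycleExtension.pow_fiber, hY, add_zero, CocycleExtension.one_fiber]
    · simp [Y, genY_pow]
  have h3 : Commute X Y := by
    refine CocycleExtension.ext ?_ ?_
    · simp [X, Y, hXY]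
    · exact mul_comm _ _
  obtain ⟨s, hs⟩ := exists_zpZpHom h1 h2 h3
  have hproj (g : ZpZp p) : (s g).proj = g := by
    rw [hs]
    simpa [X, Y] using genX_pow_mul_genY_pow g
  refine ⟨fun g => (s g).fiber, fun g h => ?_⟩
  simp only [map_mul, CocycleExtension.mul_fiber, hproj]
  abel

end CocycleExtension

/-! ### Three cocycles -/

section Cocycles

/-- The carry in the addition of two residues modulo `p`. -/
def carry {p : ℕ} (a b : ZMod p) : ℕ := (a.val + b.val) / p

theorem carry_comm {p : ℕ} (a b : ZMod p) : carry a b = carry b a := by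
  rw [carry, carry, add_comm]

variable {p : ℕ} [Fact p.Prime]

theorem mul_carry_add_val (a b : ZMod p) : p * carry a b + (a + b).val = a.val + b.val := by
  rw [carry, ZMod.val_add]
  exact Nat.div_add_mod _ _

theorem carry_cocycle (a b c : ZMod p) :
    carry b c + carry a (b + c) = carry (a + b) c + carry a b := by
  apply Nat.eq_of_mul_eq_mul_left (Fact.out : p.Prime).pos
  have h1 := mul_carry_add_val b c
  have h2 := mul_carry_add_val a (b + c)
  have h3 := mul_carry_add_val (a + b) c
  have h4 := mul_carry_add_val a b
  rw [add_assoc a b c] at h3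
  linarith

theorem carry_zero_left (a : ZMod p) : carry 0 a = 0 := by
  simp [carry, Nat.div_eq_zero_iff, ZMod.val_lt]

theorem sum_carry_one : ∑ i ∈ Finset.range p, carry (i : ZMod p) 1 = 1 := by
  have : Fact (1 < p) := ⟨(Fact.out : p.Prime).one_lt⟩
  have h (n : ℕ) : p * ∑ i ∈ Finset.range n, carry (i : ZMod p) 1 + (n : ZMod p).val = n := by
    induction n with
    | zero => simp
    | succ n ih =>
      have := mul_carry_add_val (n : ZMod p) 1
      rw [ZMod.val_one] at this
      rw [Finset.sum_range_succ, mul_add]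
      push_cast
      omega
  have hp := h p
  rw [ZMod.natCast_self, ZMod.val_zero, add_zero] at hp
  exact Nat.eq_of_mul_eq_mul_left (Fact.out : p.Prime).pos (by rw [hp, mul_one])

/-- Three 2-cocycles on `ℤ_p ⊕ ℤ_p`: the two carries, whose extensions replace one of the factors
by `ℤ_{p²}`, and a bilinear form, whose extension is a Heisenberg group. -/
def stdCocycle (k : Fin 3) (g h : ZpZp p) : ZMod p :=
  ![(carry g.toAdd.1 h.toAdd.1 : ZMod p), (carry g.toAdd.2 h.toAdd.2 : ZMod p),
    g.toAdd.1 * h.toAdd.2] k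

theorem isTrivialCocycle_stdCocycle (k : Fin 3) :
    IsTrivialCocycle (stdCocycle k : ZpZp p → ZpZp p → ZMod p) := by
  intro g h l
  have hc (a b c : ZMod p) : (carry b c : ZMod p) + carry a (b + c) =
      carry (a + b) c + carry a b := by
    exact_mod_cast congrArg (Nat.cast : ℕ → ZMod p) (carry_cocycle a b c)
  match k with
  | 0 => exact hc _ _ _
  | 1 => exact hc _ _ _
  | 2 =>
    simp [stdCocycle]
    ring

variable (p) in
/-- The 2-cycles in the bar complex that correspond to the relators `x ^ p`, `y ^ p` and
`[x, y]`. -/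
def stdCycle (k : Fin 3) : ZpZp p × ZpZp p →₀ ZMod p :=
  ![∑ i ∈ Finset.range p, Finsupp.single (genX p ^ i, genX p) 1,
    ∑ i ∈ Finset.range p, Finsupp.single (genY p ^ i, genY p) 1,
    Finsupp.single (genX p, genY p) 1 - Finsupp.single (genY p, genX p) 1] k

theorem linearCombination_stdCocycle_stdCycle (k l : Fin 3) :
    Finsupp.linearCombination (ZMod p) (fun g : ZpZp p × ZpZp p => stdCocycle k g.1 g.2)
      (stdCycle p l) = if k = l then 1 else 0 := by
  have hs : ∑ i ∈ Finset.range p, ((carry (i : ZMod p) 1 : ℕ) : ZMod p) = 1 := by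
    exact_mod_cast congrArg (Nat.cast : ℕ → ZMod p) (sum_carry_one (p := p))
  fin_cases k <;> fin_cases l <;>
    simp [stdCycle, stdCocycle, genX_pow, genY_pow, map_sum, carry_zero_left] <;>
    simp [genX, genY, hs, carry_zero_left, carry_comm _ (0 : ZMod p)]

end Cocycles

/-! ### The second homology group -/

/-- A quotient `Z / B` has dimension `n` if `n` functionals vanishing on `B` and `n` elements of `Z`
are dual to each other, and every functional vanishing on `B` and on these elements vanishes on
`Z`. -/
theorem finrank_eq_of_dual_pair {K V H : Type*} [Field K] [AddCommGroup V] [Module K V]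
    [AddCommGroup H] [Module K H] {B Z : Submodule K V} (π : Z →ₗ[K] H)
    (hπ : Function.Surjective π) (hker : ∀ x, π x = 0 ↔ x.1 ∈ B) {n : ℕ}
    (c : Fin n → V →ₗ[K] K) (z : Fin n → V) (hc : ∀ i, ∀ x ∈ B, c i x = 0) (hz : ∀ i, z i ∈ Z)
    (hcz : ∀ i j, c i (z j) = if i = j then 1 else 0)
    (hdual : ∀ f : V →ₗ[K] K, (∀ x ∈ B, f x = 0) → (∀ i, f (z i) = 0) → ∀ x ∈ Z, f x = 0) :
    Module.finrank K H = n := by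
  let e : Z →ₗ[K] (Fin n → K) := LinearMap.pi fun i => c i ∘ₗ Z.subtype
  have he : Function.Surjective e := by
    intro v
    refine ⟨∑ i, v i • ⟨z i, hz i⟩, ?_⟩
    ext i
    simp [e, hcz]
  have hek : LinearMap.ker π = LinearMap.ker e := by
    ext x
    rw [LinearMap.mem_ker, LinearMap.mem_ker, hker]
    constructor
    · intro hx
      ext i
      exact hc i x hx
    · intro hx
      by_contra hxB
      obtain ⟨f, hfx, hfB⟩ := Submodule.exists_le_ker_of_notMem hxB
      have h := hdual (f - ∑ i, f (z i) • c i) (fun y hy => ?_) (fun j => ?_) x x.2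
      · have hx' (i : Fin n) : c i x = 0 := congrFun hx i
        simp [hx'] at h
        exact hfx h
      · have : f y = 0 := hfB hy
        simp [this, hc _ y hy]
      · simp [hcz]
  rw [← (π.quotKerEquivOfSurjective hπ).finrank_eq, hek,
    (e.quotKerEquivOfSurjective he).finrank_eq, Module.finrank_fin_fun]

variable (p : ℕ) [Fact p.Prime]

open groupHomology in
/-- The three cocycles and the three cycles form a dual pair. A functional on the 2-chains that
vanishes on boundaries is a 2-cocycle; if it vanishes on the three cycles as well, it is a
coboundary, and so vanishes on all cycles. -/
theorem finrank_groupHomology_two :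
    Module.finrank (ZMod p)
      (groupHomology (Rep.trivial (ZMod p) (ZpZp p) (ZMod p)) 2) = 3 := by
  set A := Rep.trivial (ZMod p) (ZpZp p) (ZMod p)
  have hd21 (g h : ZpZp p) : (d₂₁ A).hom (Finsupp.single (g, h) (1 : ZMod p)) =
      Finsupp.single h (1 : ZMod p) - Finsupp.single (g * h) (1 : ZMod p) +
        Finsupp.single g (1 : ZMod p) := by
    rw [d₂₁_single]
    simp [A]
  have hd32 (g h k : ZpZp p) (a : ZMod p) : (d₃₂ A).hom (Finsupp.single (g, h, k) a) =
      Finsupp.single (h, k) a - Finsupp.single (g * h, k) a + Finsupp.single (g, h * k) a -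
        Finsupp.single (g, h) a := by
    rw [d₃₂_single]
    simp [A]
  refine finrank_eq_of_dual_pair (B := boundaries₂ A) (Z := cycles₂ A) (H2π A).hom
    ((ModuleCat.epi_iff_surjective _).1 inferInstance) (fun x => H2π_eq_zero_iff x)
    (fun k => Finsupp.linearCombination (ZMod p) fun g => stdCocycle k g.1 g.2) (stdCycle p)
    ?_ ?_ linearCombination_stdCocycle_stdCycle ?_
  · rintro k _ ⟨x, rfl⟩
    induction x using Finsupp.induction_linear with
    | zero => simp
    | add x y hx hy => rw [map_add, map_add, hx, hy, add_zero]
    | single g a =>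
      obtain ⟨g, h, l⟩ := g
      rw [hd32]
      simp only [map_sub, map_add, Finsupp.linearCombination_single, smul_eq_mul]
      linear_combination a * isTrivialCocycle_stdCocycle k g h l
  · intro k
    change (d₂₁ A).hom (stdCycle p k) = 0
    have htel (x : ZpZp p) (hx : x ^ p = 1) : ∑ i ∈ Finset.range p,
        (d₂₁ A).hom (Finsupp.single (x ^ i, x) (1 : ZMod p)) = 0 := by
      have h (n : ℕ) : ∑ i ∈ Finset.range n,
          (d₂₁ A).hom (Finsupp.single (x ^ i, x) (1 : ZMod p)) =
            Finsupp.single x (n : ZMod p) + Finsupp.single 1 (1 : ZMod p) -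
              Finsupp.single (x ^ n) (1 : ZMod p) := by
        induction n with
        | zero => simp
        | succ n ih =>
          rw [Finset.sum_range_succ, ih, hd21, ← pow_succ]
          push_cast
          rw [Finsupp.single_add]
          abel
      rw [h, hx, CharP.cast_eq_zero]
      simp
    match k with
    | 0 => exact (map_sum _ _ _).trans (htel _ (by simp [genX_pow]))
    | 1 => exact (map_sum _ _ _).trans (htel _ (by simp [genY_pow]))
    | 2 =>
      refine (map_sub _ _ _).trans ?_
      rw [hd21, hd21, mul_comm (genY p)]
      abel
  · intro f hB hz x hx
    let φ : ZpZp p → ZpZp p → ZMod p := fun g h => f (Finsupp.single (g, h) (1 : ZMod p))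
    have hφ : IsTrivialCocycle φ := by
      intro g h k
      have h0 := hB _ ⟨Finsupp.single (g, h, k) (1 : ZMod p), rfl⟩
      rw [hd32, map_sub, map_add, map_sub] at h0
      linear_combination h0
    have h0 : ∑ i ∈ Finset.range p, φ (genX p ^ i) (genX p) = 0 :=
      (map_sum f _ _).symm.trans (hz 0)
    have h1 : ∑ i ∈ Finset.range p, φ (genY p ^ i) (genY p) = 0 :=
      (map_sum f _ _).symm.trans (hz 1)
    have h2 : φ (genX p) (genY p) = φ (genY p) (genX p) :=
      sub_eq_zero.1 ((map_sub f _ _).symm.trans (hz 2))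
    obtain ⟨ψ, hψ⟩ := exists_coboundary_of_relators hφ h0 h1 h2
    have hf : f = -(Finsupp.linearCombination (ZMod p) ψ ∘ₗ (d₂₁ A).hom) := by
      refine Finsupp.lhom_ext' fun g => LinearMap.ext_ring ?_
      change φ g.1 g.2 = -(Finsupp.linearCombination (ZMod p) ψ
        ((d₂₁ A).hom (Finsupp.single (g.1, g.2) (1 : ZMod p))))
      rw [hd21, map_add, map_sub, hψ]
      simp only [Finsupp.linearCombination_single, one_smul]
      ring
    have hx : (d₂₁ A).hom x = 0 := hx
    rw [hf]
    change -(Finsupp.linearCombination (ZMod p) ψ ((d₂₁ A).hom x)) = 0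
    rw [hx, map_zero, neg_zero]

/-! ### Holonomy in the free groupoid of a graph -/

section Holonomy

open CategoryTheory

variable {V : Type*} [Quiver V]

/-- The arrows of the free groupoid are generated by the arrows of the quiver. -/
theorem freeGroupoid_induction {motive : ∀ {a b : V},
      ((Quiver.FreeGroupoid.of V).obj a ⟶ (Quiver.FreeGroupoid.of V).obj b) → Prop}
    (id : ∀ a, motive (𝟙 ((Quiver.FreeGroupoid.of V).obj a)))
    (comp : ∀ {a b c} (f : (Quiver.FreeGroupoid.of V).obj a ⟶ (Quiver.FreeGroupoid.of V).obj b)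
      (g : (Quiver.FreeGroupoid.of V).obj b ⟶ (Quiver.FreeGroupoid.of V).obj c),
      motive f → motive g → motive (f ≫ g))
    (of : ∀ {a b : V} (e : a ⟶ b), motive ((Quiver.FreeGroupoid.of V).map e))
    (inv : ∀ {a b} (f : (Quiver.FreeGroupoid.of V).obj a ⟶ (Quiver.FreeGroupoid.of V).obj b),
      motive f → motive (Groupoid.inv f))
    {a b : V} (f : (Quiver.FreeGroupoid.of V).obj a ⟶ (Quiver.FreeGroupoid.of V).obj b) : motive f := by
  obtain ⟨w, rfl⟩ : ∃ w : @Quiver.Path (Quiver.Symmetrify V) _ a b,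
      (Quotient.functor (Quiver.FreeGroupoid.redStep (V := V))).map w = f := by
    induction f using Quot.inductionOn with
    | h w => exact ⟨w, rfl⟩
  induction w with
  | nil => exact id a
  | @cons b c w e ih =>
    have he : motive ((Quotient.functor (Quiver.FreeGroupoid.redStep (V := V))).map
        (Quiver.Hom.toPath (V := Quiver.Symmetrify V) e)) := by
      rcases (show (Quiver.Hom b c) ⊕ (Quiver.Hom c b) from e) with e | e
      · exact of e
      · exact inv _ (of e)
    exact comp _ _ ih he

variable {H : Type*} [Group H]

/-- The extension of a labelling of the arrows of a quiver by elements of a group to all arrows of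
the free groupoid; the label of a composite `f ≫ g` is the product of the labels of `f` and `g`, in
this order. -/
def holonomy (l : ∀ {a b : V}, (a ⟶ b) → H) {a b : Quiver.FreeGroupoid V} (f : a ⟶ b) : H :=
  MulOpposite.unop ((Quiver.FreeGroupoid.lift (V' := CategoryTheory.SingleObj Hᵐᵒᵖ)
    { obj := fun _ => CategoryTheory.SingleObj.star Hᵐᵒᵖ, map := fun e => MulOpposite.op (l e) }).map f)

variable (l : ∀ {a b : V}, (a ⟶ b) → H)

@[simp]
theorem holonomy_id (a : Quiver.FreeGroupoid V) : holonomy l (𝟙 a) = 1 := by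
  rw [holonomy, CategoryTheory.Functor.map_id]
  rfl

@[simp]
theorem holonomy_comp {a b c : Quiver.FreeGroupoid V} (f : a ⟶ b) (g : b ⟶ c) :
    holonomy l (f ≫ g) = holonomy l f * holonomy l g := by
  rw [holonomy, CategoryTheory.Functor.map_comp]
  rfl

@[simp]
theorem holonomy_inv {a b : Quiver.FreeGroupoid V} (f : a ⟶ b) :
    holonomy l (Groupoid.inv f) = (holonomy l f)⁻¹ := by
  rw [eq_inv_iff_mul_eq_one, ← holonomy_comp, Groupoid.inv_comp, holonomy_id]

@[simp]
theorem holonomy_of {a b : V} (e : a ⟶ b) : holonomy l ((Quiver.FreeGroupoid.of V).map e) = l e :=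
  one_mul (l e)

/-- The labelling of the loops at a vertex, as a homomorphism. -/
def holonomyHom (a : Quiver.FreeGroupoid V) : (a ⟶ a) →* H where
  toFun f := holonomy l f
  map_one' := holonomy_id l a
  map_mul' f g := holonomy_comp l f g

@[simp]
theorem holonomyHom_apply (a : Quiver.FreeGroupoid V) (f : a ⟶ a) :
    holonomyHom l a f = holonomy l f := rfl

end Holonomy

/-! ### The central extension defined by the three cocycles -/

section StdExtension

variable {p : ℕ} [Fact p.Prime]

theorem stdCocycle_one_left (k : Fin 3) (g : ZpZp p) : stdCocycle k 1 g = 0 := by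
  fin_cases k <;> simp [stdCocycle, carry_zero_left]

theorem stdCocycle_one_right (k : Fin 3) (g : ZpZp p) : stdCocycle k g 1 = 0 := by
  fin_cases k <;> simp [stdCocycle, carry_zero_left, carry_comm _ (0 : ZMod p)]

/-- The three cocycles, as a cocycle with values in `ℤ_p³`. -/
def stdCocycleVec (g h : ZpZp p) : Fin 3 → ZMod p := fun k => stdCocycle k g h

@[simp]
theorem stdCocycleVec_apply (g h : ZpZp p) (k : Fin 3) :
    stdCocycleVec g h k = stdCocycle k g h := rfl

theorem isTrivialCocycle_stdCocycleVec :
    IsTrivialCocycle (stdCocycleVec : ZpZp p → ZpZp p → Fin 3 → ZMod p) :=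
  fun g h l => funext fun k => isTrivialCocycle_stdCocycle k g h l

variable (p) in
/-- The central extension of `ℤ_p ⊕ ℤ_p` by `ℤ_p³` defined by the three cocycles. -/
abbrev StdExtension : Type :=
  CocycleExtension (stdCocycleVec : ZpZp p → ZpZp p → Fin 3 → ZMod p)
    isTrivialCocycle_stdCocycleVec

namespace StdExtension

theorem mul_fiber_of_left {a b : StdExtension p} (ha : a.proj = 1) :
    (a * b).fiber = a.fiber + b.fiber := by
  ext k
  simp [ha, stdCocycle_one_left]

/-- The kernel of the projection is central. -/
theorem commute_of_proj {a : StdExtension p} (ha : a.proj = 1) (b : StdExtension p) :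
    Commute a b := by
  refine CocycleExtension.ext ?_ ?_
  · ext k
    simp [ha, stdCocycle_one_left, stdCocycle_one_right, add_comm]
  · simp [ha]

theorem pow_fiber (a : StdExtension p) (n : ℕ) (k : Fin 3) :
    (a ^ n).fiber k = n * a.fiber k + ∑ i ∈ Finset.range n, stdCocycle k (a.proj ^ i) a.proj := by
  induction n with
  | zero => simp [stdCocycle_one_left]
  | succ n ih =>
    rw [pow_succ, CocycleExtension.mul_fiber, Pi.add_apply, Pi.add_apply, ih,
      Finset.sum_range_succ, CocycleExtension.pow_proj,
      stdCocycleVec_apply]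
    push_cast
    ring

theorem pow_fiber_genX {a : StdExtension p} (ha : a.proj = genX p) :
    (a ^ p).fiber = Pi.single 0 1 := by
  ext k
  have h := linearCombination_stdCocycle_stdCycle (p := p) k 0
  rw [pow_fiber, ha]
  simp only [stdCycle, Matrix.cons_val_zero, map_sum, Finsupp.linearCombination_single,
    one_smul] at h
  simp [h, Pi.single_apply]

theorem pow_fiber_genY {a : StdExtension p} (ha : a.proj = genY p) :
    (a ^ p).fiber = Pi.single 1 1 := by
  ext k
  have h := linearCombination_stdCocycle_stdCycle (p := p) k 1
  rw [pow_fiber, ha]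
  simp only [stdCycle, Matrix.cons_val_one, Matrix.cons_val_zero, map_sum,
    Finsupp.linearCombination_single, one_smul] at h
  simp [h, Pi.single_apply]

theorem commutator_fiber {a b : StdExtension p} (ha : a.proj = genX p) (hb : b.proj = genY p) :
    (a * b * a⁻¹ * b⁻¹).fiber = Pi.single 2 1 := by
  have h1 : (a * b * a⁻¹ * b⁻¹).proj = 1 := by
    simp [mul_comm a.proj]
  have h2 : a * b * a⁻¹ * b⁻¹ * (b * a) = a * b := by group
  have h3 := congrArg CocycleExtension.fiber h2
  rw [mul_fiber_of_left h1, CocycleExtension.mul_fiber b, CocycleExtension.mul_fiber a] at h3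
  ext k
  have h := linearCombination_stdCocycle_stdCycle (p := p) k 2
  simp only [stdCycle, Matrix.cons_val, map_sub, Finsupp.linearCombination_single, one_smul] at h
  have h4 := congrFun h3 k
  simp only [Pi.add_apply, stdCocycleVec_apply, ha, hb] at h4
  rw [Pi.single_apply, ← h]
  linear_combination h4

end StdExtension

end StdExtension

/-- The projection of a cocycle extension, as a homomorphism. -/
def CocycleExtension.projHom {G A : Type*} [Group G] [AddCommGroup A] {φ : G → G → A}
    (hφ : IsTrivialCocycle φ) : CocycleExtension φ hφ →* G where
  toFun := CocycleExtension.proj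
  map_one' := rfl
  map_mul' _ _ := rfl

/-! ### The Euler characteristic of a 2-complex -/

section EulerChar

open CategoryTheory

/-- A homomorphism from the group of loops at `x` to `G`, transported along chosen paths from `x`,
lifts through any surjection `E → G` to a holonomy: the free groupoid is free. -/
theorem exists_holonomy_lift {V : Type*} [Quiver V] {x : V}
    (γ : ∀ v, (Quiver.FreeGroupoid.of V).obj x ⟶ (Quiver.FreeGroupoid.of V).obj v)
    {G E : Type*} [Group G] [Group E] (pr : E →* G) (hpr : Function.Surjective pr)
    (q : ((Quiver.FreeGroupoid.of V).obj x ⟶ (Quiver.FreeGroupoid.of V).obj x) →* G) :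
    ∃ l : ∀ {a b : V}, (a ⟶ b) → E, ∀ {a b : V}
      (f : (Quiver.FreeGroupoid.of V).obj a ⟶ (Quiver.FreeGroupoid.of V).obj b),
      pr (holonomy l f) = q (γ a ≫ f ≫ Groupoid.inv (γ b)) := by
  choose s hs using hpr
  refine ⟨fun {a b} e => s (q (γ a ≫ (Quiver.FreeGroupoid.of V).map e ≫ Groupoid.inv (γ b))),
    fun {a b} f => ?_⟩
  have hone (a : V) : γ a ≫ 𝟙 _ ≫ Groupoid.inv (γ a) = 1 := by
    rw [Category.id_comp, Groupoid.comp_inv]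
    rfl
  have hmul {a b c : V} (f : (Quiver.FreeGroupoid.of V).obj a ⟶ (Quiver.FreeGroupoid.of V).obj b)
      (g : (Quiver.FreeGroupoid.of V).obj b ⟶ (Quiver.FreeGroupoid.of V).obj c) :
      γ a ≫ (f ≫ g) ≫ Groupoid.inv (γ c) =
        (γ a ≫ f ≫ Groupoid.inv (γ b)) * (γ b ≫ g ≫ Groupoid.inv (γ c)) := by
    change _ = (γ a ≫ f ≫ Groupoid.inv (γ b)) ≫ (γ b ≫ g ≫ Groupoid.inv (γ c))
    simp
  induction f using freeGroupoid_induction with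
  | id a => rw [holonomy_id, map_one, hone, map_one]
  | comp f g hf hg => rw [holonomy_comp, map_mul, hf, hg, hmul, map_mul]
  | of e => rw [holonomy_of, hs]
  | inv f hf =>
    rw [holonomy_inv, map_inv, hf, inv_eq_iff_mul_eq_one, ← map_mul, ← hmul, Groupoid.comp_inv,
      hone, map_one]

variable {p : ℕ} [Fact p.Prime]

/-- Let `V`, `E`, `F` be the numbers of cells. The loops at `x` map to the central extension
`StdExtension p`, with the attaching loops landing in its kernel `ℤ_p³`. Evaluating 1-cochains and
functionals on this kernel along the attaching loops gives a linear map `ℤ_p^E × ℤ_p³ → ℤ_p^F`.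
On its kernel, the functional is zero, because the relators of `ℤ_p ⊕ ℤ_p`, lifted to loops, reach
generators of `ℤ_p³`; and then the 1-cochain is determined by its values on paths to the other
vertices and on two loops. Hence `E + 3 ≤ F + (V - 1) + 2`. -/
theorem TwoComplex.two_le_eulerChar (K : TwoComplex.{u}) (x : K.Vertex) (hfin : K.IsFinite)
    (hconn : K.IsConnected) (e : K.π₁ x ≃* ZpZp p) : 2 ≤ K.eulerChar := by
  have := hfin.vertex
  have := hfin.edge
  have := hfin.face
  cases nonempty_fintype K.Vertex
  cases nonempty_fintype K.Edge
  cases nonempty_fintype K.Face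
  classical
  -- paths from the base point to all vertices
  obtain ⟨γ, hγ⟩ : ∃ γ : ∀ v, K.pt x ⟶ K.pt v, γ x = 𝟙 _ := by
    let γ : ∀ v, K.pt x ⟶ K.pt v := fun v =>
      (CategoryTheory.Quotient.functor (Quiver.FreeGroupoid.redStep (V := K.Vertex))).map
        (hconn.joined x v).some
    exact ⟨Function.update γ x (𝟙 _), Function.update_self _ _ _⟩
  -- the projection from the loops at the base point to the fundamental group
  let q : (K.pt x ⟶ K.pt x) →* ZpZp p := e.toMonoidHom.comp (QuotientGroup.mk' _)
  have hq : Function.Surjective q := e.surjective.comp (QuotientGroup.mk'_surjective _)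
  have hqker (r : K.pt x ⟶ K.pt x) : q r = 1 ↔ r ∈ Subgroup.normalClosure (K.faceLoops x) := by
    rw [← QuotientGroup.eq_one_iff]
    exact map_eq_one_iff e e.injective
  obtain ⟨L, hL⟩ := exists_holonomy_lift (V := K.Vertex) γ
    (CocycleExtension.projHom (isTrivialCocycle_stdCocycleVec (p := p)))
    (fun g => ⟨⟨0, g⟩, rfl⟩) q
  have hLloop (r : K.pt x ⟶ K.pt x) : (holonomy L r).proj = q r := by
    have h := hL (a := x) (b := x) r
    rw [hγ, Category.id_comp] at h
    refine h.trans (congrArg q ?_)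
    rw [Groupoid.inv_eq_inv, IsIso.inv_id, Category.comp_id]
  have hLface (f : K.Face) : (holonomy L (K.attachClass f)).proj = 1 := by
    refine (hL _).trans ((hqker _).2 (Subgroup.subset_normalClosure ⟨f, γ _, rfl⟩))
  -- the universal labelling of the edges by functionals on `Edge → ℤ_p`
  let A : ∀ {a b : K.Vertex}, (a ⟶ b) → Multiplicative ((K.Edge → ZMod p) →ₗ[ZMod p] ZMod p) :=
    fun {a b} e => Multiplicative.ofAdd (LinearMap.proj (⟨a, b, e⟩ : K.Edge))
  let coch {a b : K.GraphGroupoid} (f : a ⟶ b) : (K.Edge → ZMod p) →ₗ[ZMod p] ZMod p :=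
    (holonomy A f).toAdd
  have coch_comp {a b c : K.GraphGroupoid} (f : a ⟶ b) (g : b ⟶ c) :
      coch (f ≫ g) = coch f + coch g := congrArg Multiplicative.toAdd (holonomy_comp A f g)
  have coch_inv {a b : K.GraphGroupoid} (f : a ⟶ b) : coch (Groupoid.inv f) = -coch f :=
    congrArg Multiplicative.toAdd (holonomy_inv A f)
  have coch_of {a b : K.Vertex} (e : a ⟶ b) :
      coch ((Quiver.FreeGroupoid.of K.Vertex).map e) = LinearMap.proj (⟨a, b, e⟩ : K.Edge) :=
    congrArg Multiplicative.toAdd (holonomy_of A e)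
  have coch_mul (r s : K.pt x ⟶ K.pt x) : coch (r * s) = coch r + coch s := coch_comp r s
  have coch_loop_inv (r : K.pt x ⟶ K.pt x) : coch r⁻¹ = -coch r := coch_inv r
  have coch_pow (r : K.pt x ⟶ K.pt x) (n : ℕ) : coch (r ^ n) = n • coch r :=
    congrArg Multiplicative.toAdd (map_pow (holonomyHom A (K.pt x)) r n)
  have coch_id (a : K.GraphGroupoid) : coch (𝟙 a) = 0 :=
    congrArg Multiplicative.toAdd (holonomy_id A a)
  -- the evaluation of a 1-cochain and of a functional on the kernel of the central extension
  let val {a b : K.GraphGroupoid} (f : a ⟶ b) :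
      (K.Edge → ZMod p) × (Fin 3 → ZMod p) →ₗ[ZMod p] ZMod p :=
    (coch f).coprod (∑ k, (holonomy L f).fiber k • LinearMap.proj k)
  have val_apply {a b : K.GraphGroupoid} (f : a ⟶ b)
      (z : (K.Edge → ZMod p) × (Fin 3 → ZMod p)) :
      val f z = coch f z.1 + ∑ k, (holonomy L f).fiber k * z.2 k := by
    simp [val]
  have val_mul {r s : K.pt x ⟶ K.pt x} (hr : q r = 1) : val (r * s) = val r + val s := by
    have h : (holonomy L (r * s)).fiber = (holonomy L r).fiber + (holonomy L s).fiber := by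
      rw [← StdExtension.mul_fiber_of_left ((hLloop r).trans hr)]
      exact congrArg _ (holonomy_comp L r s)
    refine LinearMap.ext fun z => ?_
    rw [LinearMap.add_apply, val_apply, val_apply, val_apply, h, coch_mul]
    simp only [LinearMap.add_apply, Pi.add_apply, add_mul, Finset.sum_add_distrib]
    ring
  have val_one : val (1 : K.pt x ⟶ K.pt x) = 0 := by
    have h := val_mul (r := 1) (s := 1) (map_one q)
    rwa [mul_one, left_eq_add] at h
  have val_conj (f : K.Face) (δ : K.pt x ⟶ K.pt (K.base f)) :
      val (δ ≫ K.attachClass f ≫ Groupoid.inv δ) = val (K.attachClass f) := by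
    have h : holonomy L (δ ≫ K.attachClass f ≫ Groupoid.inv δ) =
        holonomy L (K.attachClass f) := by
      rw [holonomy_comp, holonomy_comp, holonomy_inv, ← mul_assoc,
        ← (StdExtension.commute_of_proj (hLface f) _).eq, mul_inv_cancel_right]
    refine LinearMap.ext fun z => ?_
    rw [val_apply, val_apply, h, coch_comp, coch_comp, coch_inv, add_neg_cancel_comm_assoc]
  obtain ⟨X, hX⟩ := hq (genX p)
  obtain ⟨Y, hY⟩ := hq (genY p)
  let Ψ : (K.Edge → ZMod p) × (Fin 3 → ZMod p) →ₗ[ZMod p] (K.Face → ZMod p) :=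
    LinearMap.pi fun f => val (K.attachClass f)
  let Θ : (K.Edge → ZMod p) × (Fin 3 → ZMod p) →ₗ[ZMod p]
      ({v // v ≠ x} → ZMod p) × (ZMod p × ZMod p) :=
    ((LinearMap.pi fun v => coch (γ v.1)).prod ((coch X).prod (coch Y))) ∘ₗ
      LinearMap.fst _ _ _
  have hinj : Function.Injective (Ψ.prod Θ) := by
    rw [← LinearMap.ker_eq_bot, LinearMap.ker_eq_bot']
    intro z hz
    obtain ⟨hΨ, hΘ⟩ := Prod.ext_iff.1 hz
    have hΨ (f : K.Face) : val (K.attachClass f) z = 0 := congrFun hΨ f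
    obtain ⟨hΘ, hXY⟩ := Prod.ext_iff.1 hΘ
    obtain ⟨hX0, hY0⟩ := Prod.ext_iff.1 hXY
    have hX0 : coch X z.1 = 0 := hX0
    have hY0 : coch Y z.1 = 0 := hY0
    have hγ0 (v : K.Vertex) : coch (γ v) z.1 = 0 := by
      by_cases hv : v = x
      · subst hv
        rw [hγ, coch_id, LinearMap.zero_apply]
      · exact congrFun hΘ ⟨v, hv⟩
    -- the evaluation vanishes on all relators
    have hrel (r : K.pt x ⟶ K.pt x) (hr : q r = 1) : val r z = 0 := by
      have hr' : r ∈ Subgroup.closure (Group.conjugatesOfSet (K.faceLoops x)) := (hqker r).1 hr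
      have hmem (s : K.pt x ⟶ K.pt x)
          (hs : s ∈ Subgroup.closure (Group.conjugatesOfSet (K.faceLoops x))) : q s = 1 :=
        (hqker s).2 hs
      clear hr
      induction hr' using Subgroup.closure_induction with
      | mem c hc =>
        obtain ⟨_, ⟨f, δ, rfl⟩, hc⟩ := Group.mem_conjugatesOfSet_iff.1 hc
        obtain ⟨g, rfl⟩ := isConj_iff.1 hc
        have h : g * (δ ≫ K.attachClass f ≫ Groupoid.inv δ) * g⁻¹ =
            (g ≫ δ) ≫ K.attachClass f ≫ Groupoid.inv (g ≫ δ) := by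
          change (g ≫ δ ≫ K.attachClass f ≫ Groupoid.inv δ) ≫ Groupoid.inv g = _
          simp [Groupoid.inv_eq_inv]
        rw [h, val_conj, hΨ]
      | one => rw [val_one, LinearMap.zero_apply]
      | mul r s hr hs hr0 hs0 => rw [val_mul (hmem r hr), LinearMap.add_apply, hr0, hs0, add_zero]
      | inv r hr hr0 =>
        have h := LinearMap.congr_fun (val_mul (s := r⁻¹) (hmem r hr)) z
        rw [mul_inv_cancel, val_one, LinearMap.add_apply, hr0, zero_add] at h
        exact h.symm
    -- on lifts of the relators `x ^ p`, `y ^ p`, `[x, y]` it takes the coordinates of the functional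
    have hXp : val (X ^ p) z = z.2 0 := by
      have h : holonomy L (X ^ p) = holonomy L X ^ p := map_pow (holonomyHom L (K.pt x)) X p
      rw [val_apply, h, StdExtension.pow_fiber_genX ((hLloop X).trans hX), coch_pow]
      simp [hX0, Pi.single_apply]
    have hYp : val (Y ^ p) z = z.2 1 := by
      have h : holonomy L (Y ^ p) = holonomy L Y ^ p := map_pow (holonomyHom L (K.pt x)) Y p
      rw [val_apply, h, StdExtension.pow_fiber_genY ((hLloop Y).trans hY), coch_pow]
      simp [hY0, Pi.single_apply]
    have hcomm : val (X * Y * X⁻¹ * Y⁻¹) z = z.2 2 := by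
      have h : holonomy L (X * Y * X⁻¹ * Y⁻¹) =
          holonomy L X * holonomy L Y * (holonomy L X)⁻¹ * (holonomy L Y)⁻¹ := by
        simp only [← holonomyHom_apply, map_mul, map_inv]
      rw [val_apply, h,
        StdExtension.commutator_fiber ((hLloop X).trans hX) ((hLloop Y).trans hY),
        coch_mul, coch_mul, coch_mul, coch_loop_inv, coch_loop_inv]
      simp [Pi.single_apply]
    have ht : z.2 = 0 := by
      rw [hrel _ (by rw [map_pow, hX, genX_pow]; simp)] at hXp
      rw [hrel _ (by rw [map_pow, hY, genY_pow]; simp)] at hYp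
      rw [hrel _ (by
        rw [map_mul, map_mul, map_mul, map_inv, map_inv, mul_comm (q X), mul_inv_cancel_right,
          mul_inv_cancel])] at hcomm
      ext k
      match k with
      | 0 => exact hXp.symm
      | 1 => exact hYp.symm
      | 2 => exact hcomm.symm
    -- hence the 1-cochain vanishes on all loops at the base point
    have hloop (r : K.pt x ⟶ K.pt x) : coch r z.1 = 0 := by
      have hs := genX_pow_mul_genY_pow (q r)
      set s := X ^ (q r).toAdd.1.val * Y ^ (q r).toAdd.2.val with hs_def
      have hqs : q s = q r := by rw [hs_def, map_mul, map_pow, map_pow, hX, hY, hs]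
      have h := hrel (r * s⁻¹) (by rw [map_mul, map_inv, hqs, mul_inv_cancel])
      have hs0 : coch s z.1 = 0 := by
        rw [hs_def, coch_mul, coch_pow, coch_pow]
        simp [hX0, hY0]
      rw [val_apply, ht, coch_mul, coch_loop_inv] at h
      simpa [hs0] using h
    have hz1 : z.1 = 0 := by
      ext ⟨a, b, e⟩
      have h := hloop (γ a ≫ (Quiver.FreeGroupoid.of K.Vertex).map e ≫ Groupoid.inv (γ b))
      rw [coch_comp, coch_comp, coch_inv, coch_of] at h
      simp only [LinearMap.add_apply, LinearMap.neg_apply, hγ0, zero_add, neg_zero, add_zero] at h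
      exact h
    exact Prod.ext hz1 ht
  have hdim := LinearMap.finrank_le_finrank_of_injective hinj
  rw [Module.finrank_prod, Module.finrank_prod, Module.finrank_prod, Module.finrank_prod,
    Module.finrank_pi, Module.finrank_pi, Module.finrank_pi, Module.finrank_pi,
    Module.finrank_self] at hdim
  rw [TwoComplex.eulerChar]
  simp only [Nat.card_eq_fintype_card]
  have hV : Fintype.card {v // v ≠ x} + 1 = Fintype.card K.Vertex := by
    rw [Fintype.card_subtype_compl, Fintype.card_subtype_eq]
    have := Fintype.card_pos_iff.2 ⟨x⟩
    omega
  rw [Fintype.card_fin] at hdim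
  omega

end EulerChar

/-! ### The standard presentation complex -/

section Presentation

open CategoryTheory

variable {α : Type}

/-- The homomorphism from the free group on `α` to the group of loops of the bouquet of circles
indexed by `α`. -/
def freeGroupToLoops (α : Type) : FreeGroup α →*
    ((Quiver.FreeGroupoid.of (Quiver.SingleObj α)).obj (Quiver.SingleObj.star α) ⟶
      (Quiver.FreeGroupoid.of (Quiver.SingleObj α)).obj (Quiver.SingleObj.star α)) :=
  FreeGroup.lift fun a => (Quiver.FreeGroupoid.of (Quiver.SingleObj α)).map
    (X := Quiver.SingleObj.star α) (Y := Quiver.SingleObj.star α) a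

theorem freeGroupToLoops_surjective : Function.Surjective (freeGroupToLoops α) := by
  intro f
  -- the bouquet has a single vertex, so the statement makes sense for arrows between any vertices
  refine freeGroupoid_induction (V := Quiver.SingleObj α)
    (motive := fun {a b} f => ∃ w, freeGroupToLoops α w = f) ?_ ?_ ?_ ?_ f
  · exact fun a => ⟨1, map_one _⟩
  · rintro a b c f g ⟨v, rfl⟩ ⟨w, rfl⟩
    exact ⟨v * w, map_mul _ _ _⟩
  · exact fun e => ⟨FreeGroup.of e, FreeGroup.lift_apply_of⟩
  · rintro a b f ⟨v, rfl⟩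
    exact ⟨v⁻¹, map_inv _ _⟩

theorem functor_map_wordPath (w : List (α × Bool)) :
    (CategoryTheory.Quotient.functor
      (Quiver.FreeGroupoid.redStep (V := Quiver.SingleObj α))).map (TwoComplex.wordPath w) =
      freeGroupToLoops α (FreeGroup.mk w) := by
  induction w with
  | nil => exact (map_one (freeGroupToLoops α)).symm
  | cons a w ih =>
    have h : FreeGroup.mk (a :: w) = FreeGroup.mk [a] * FreeGroup.mk w := rfl
    rw [h, map_mul, ← ih]
    obtain ⟨a, _ | _⟩ := a <;>
    · refine (CategoryTheory.Functor.map_comp _ _ _).trans ?_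
      congr 1

variable {ι : Type} [DecidableEq α]

theorem attachClass_ofPresentation (r : ι → FreeGroup α) (i : ι) :
    (TwoComplex.ofPresentation r).attachClass i = freeGroupToLoops α (r i) := by
  rw [TwoComplex.attachClass]
  refine (functor_map_wordPath _).trans ?_
  rw [FreeGroup.mk_toWord]

/-- The loops of the bouquet are the words in the generators, and both the fundamental group and
`ℤ_p ⊕ ℤ_p` are universal among groups with two commuting elements of exponent `p`. -/
theorem nonempty_π₁_standardRelators (p : ℕ) [Fact p.Prime] :
    Nonempty ((TwoComplex.ofPresentation (standardRelators p)).π₁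
      (Quiver.SingleObj.star (Fin 2)) ≃* ZpZp p) := by
  set K := TwoComplex.ofPresentation (standardRelators p)
  let pt := K.pt (Quiver.SingleObj.star (Fin 2))
  let ω : FreeGroup (Fin 2) →* (pt ⟶ pt) := freeGroupToLoops (Fin 2)
  let h : (pt ⟶ pt) →* ZpZp p :=
    holonomyHom (V := Quiver.SingleObj (Fin 2)) (fun {_ _} e => (![genX p, genY p] : Fin 2 → _) e) pt
  have hω : h.comp ω = FreeGroup.lift ![genX p, genY p] := by
    refine FreeGroup.ext_hom _ _ fun a => ?_
    rw [FreeGroup.lift_apply_of]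
    refine (congrArg h FreeGroup.lift_apply_of).trans ?_
    exact holonomy_of (V := Quiver.SingleObj (Fin 2)) _ (a := Quiver.SingleObj.star _)
      (b := Quiver.SingleObj.star _) a
  have hrel (i : Fin 3) : FreeGroup.lift ![genX p, genY p] (standardRelators p i) = 1 := by
    match i with
    | 0 => simp [standardRelators, genX_pow]
    | 1 => simp [standardRelators, genY_pow]
    | 2 => simp [standardRelators, mul_comm (genX p)]
  let mk : (pt ⟶ pt) →* K.π₁ (Quiver.SingleObj.star (Fin 2)) := QuotientGroup.mk' _
  have hmk (i : Fin 3) : mk (ω (standardRelators p i)) = 1 := by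
    refine (QuotientGroup.eq_one_iff _).2 (Subgroup.subset_normalClosure ⟨i, 𝟙 _, ?_⟩)
    rw [Category.id_comp, Groupoid.inv_eq_inv, IsIso.inv_id, Category.comp_id]
    exact (attachClass_ofPresentation _ _).symm
  let φ : K.π₁ (Quiver.SingleObj.star (Fin 2)) →* ZpZp p :=
    QuotientGroup.lift _ h (by
      refine Subgroup.normalClosure_le_normal ?_
      rintro _ ⟨i, γ, rfl⟩
      have h1 : h (γ ≫ K.attachClass i ≫ Groupoid.inv γ) = h γ * h (K.attachClass i) * (h γ)⁻¹ := by
        rw [mul_assoc, ← map_inv, ← map_mul, ← map_mul]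
        rfl
      refine h1.trans ?_
      rw [mul_comm (h γ), mul_inv_cancel_right]
      have h2 := DFunLike.congr_fun hω (standardRelators p i)
      rw [hrel] at h2
      exact (congrArg h (attachClass_ofPresentation _ _)).trans h2)
  let X := mk (ω (FreeGroup.of 0))
  let Y := mk (ω (FreeGroup.of 1))
  have hX : X ^ p = 1 := by
    have := hmk 0
    simpa [standardRelators] using this
  have hY : Y ^ p = 1 := by
    have := hmk 1
    simpa [standardRelators] using this
  have hXY : Commute X Y := by
    have h2 : X * Y * X⁻¹ * Y⁻¹ = 1 := by
      have h := hmk 2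
      change mk (ω (FreeGroup.of 0 * FreeGroup.of 1 * (FreeGroup.of 0)⁻¹ *
        (FreeGroup.of 1)⁻¹)) = 1 at h
      simpa only [map_mul, map_inv] using h
    rwa [mul_inv_eq_one, mul_inv_eq_iff_eq_mul] at h2
  obtain ⟨s, hs⟩ := exists_zpZpHom hX hY hXY
  have hφX : φ X = genX p := DFunLike.congr_fun hω (FreeGroup.of 0) |>.trans FreeGroup.lift_apply_of
  have hφY : φ Y = genY p := DFunLike.congr_fun hω (FreeGroup.of 1) |>.trans FreeGroup.lift_apply_of
  refine ⟨MonoidHom.toMulEquiv φ s ?_ ?_⟩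
  · -- the loops of the bouquet are words in the generators, so it suffices to compare the generators
    have hgen : (s.comp φ).comp (mk.comp ω) = mk.comp ω := by
      refine FreeGroup.ext_hom _ _ fun a => ?_
      match a with
      | 0 =>
        change s (φ X) = X
        rw [hφX, hs]
        simp [genX, ZMod.val_one]
      | 1 =>
        change s (φ Y) = Y
        rw [hφY, hs]
        simp [genY, ZMod.val_one]
    refine MonoidHom.ext fun r => ?_
    obtain ⟨r, rfl⟩ := QuotientGroup.mk'_surjective _ r
    obtain ⟨w, rfl⟩ := freeGroupToLoops_surjective r
    exact DFunLike.congr_fun hgen w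
  · refine MonoidHom.ext fun g => ?_
    rw [MonoidHom.comp_apply, hs, map_mul, map_pow, map_pow, hφX, hφY, genX_pow_mul_genY_pow]
    rfl

/-- The edges of the bouquet of circles indexed by `α`. -/
def bouquetEdgeEquiv (α : Type) : Quiver.Total (Quiver.SingleObj α) ≃ α where
  toFun e := e.hom
  invFun a := ⟨Quiver.SingleObj.star α, Quiver.SingleObj.star α, a⟩
  left_inv _ := rfl
  right_inv _ := rfl

theorem isFinite_standardRelators (p : ℕ) :
    (TwoComplex.ofPresentation (standardRelators p)).IsFinite where
  vertex := inferInstanceAs (Finite Unit)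
  edge := .of_equiv _ (bouquetEdgeEquiv (Fin 2)).symm
  face := inferInstanceAs (Finite (Fin 3))

theorem isConnected_standardRelators (p : ℕ) :
    (TwoComplex.ofPresentation (standardRelators p)).IsConnected where
  nonempty := ⟨Quiver.SingleObj.star (Fin 2)⟩
  joined _ _ := ⟨Quiver.Path.nil⟩

theorem eulerChar_standardRelators (p : ℕ) :
    (TwoComplex.ofPresentation (standardRelators p)).eulerChar = 2 := by
  have hV : Nat.card (Quiver.SingleObj (Fin 2)) = 1 := Nat.card_unique
  have hE : Nat.card (Quiver.Total (Quiver.SingleObj (Fin 2))) = 2 := by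
    rw [Nat.card_congr (bouquetEdgeEquiv (Fin 2)), Nat.card_fin]
  have hF : Nat.card (Fin 3) = 3 := Nat.card_fin 3
  change (Nat.card (Quiver.SingleObj (Fin 2)) : ℤ) -
    Nat.card (Quiver.Total (Quiver.SingleObj (Fin 2))) + Nat.card (Fin 3) = 2
  rw [hV, hE, hF]
  norm_num

end Presentation

end

theorem claimd (p : ℕ) [Fact p.Prime] :
    -- the invariant `d(ℤ_p ⊕ ℤ_p)` equals one
    hambletonKreckD (ZpZp p) = 1 ∧
    -- a finite 2-complex with fundamental group `ℤ_p ⊕ ℤ_p` has Euler characteristic at least two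
    (∀ (K : TwoComplex.{u}) (x : K.Vertex), K.IsFinite → K.IsConnected →
      Nonempty (K.π₁ x ≃* ZpZp p) → 2 ≤ K.eulerChar) ∧
    -- the homology group `H₂(ℤ_p ⊕ ℤ_p; ℤ_p)` has rank three
    Module.finrank (ZMod p)
      (groupHomology (Rep.trivial (ZMod p) (ZpZp p) (ZMod p)) 2) = 3 ∧
    -- the bound is attained by the 2-complex that realises the standard presentation
    (TwoComplex.ofPresentation (standardRelators p)).IsFinite ∧
    (TwoComplex.ofPresentation (standardRelators p)).IsConnected ∧
    (∀ x, Nonempty ((TwoComplex.ofPresentation (standardRelators p)).π₁ x ≃* ZpZp p)) ∧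
    (TwoComplex.ofPresentation (standardRelators p)).eulerChar = 2 :=
  ⟨hambletonKreckD_ZpZp p,
    fun K x hfin hconn ⟨e⟩ => K.two_le_eulerChar x hfin hconn e,
    finrank_groupHomology_two p,
    isFinite_standardRelators p,
    isConnected_standardRelators p,
    fun _ => nonempty_π₁_standardRelators p,
    eulerChar_standardRelators p⟩
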